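/- An \emph{involutive graph} consists of a set $X_0$ of vertices, a set $X_1$ of edges, maps $s,t:X_1\to X_0$ and a map $\iota:X_1\to X_1$ with $\iota^2=\mathrm{id}$ and $s\iota=t$; morphisms are pairs of maps commuting with $s,t,\iota$. Let $U:\mathbf{Gpd}\to\mathbf{InvGraph}$ be the forgetful functor from (small) groupoids to involutive graphs, with vertices the objects, edges the morphisms and $\iota(f)=f^{-1}$. Its left adjoint $F$ takes $X$ to the groupoid whose objects are the vertices of $X$ and whose morphisms are the paths in $X$ modulo the relations $(f,\iota f)\sim\mathrm{id}$ for all edges $f$; the \emph{free groupoid monad} $G$ is the monad on $\mathbf{InvGraph}$ induced by $F\dashv U$. Let $\mathbf{Acyc}\subset\mathbf{InvGraph}$ be the full subcategory spanned by the finite (non-empty) connected acyclic combinatorial graphs, each viewed as an involutive graph with a unique edge $a\to b$ for every ordered pair $(a,b)$ of adjacent vertices. \textbf{Theorem.} $G$ is a monad with arities $\mathbf{Acyc}$. That is: $\mathbf{Acyc}$ is a dense generator of $\mathbf{InvGraph}$, i.e. it is essentially small and the nerve functor $\nu:\mathbf{InvGraph}\to\mathrm{PSh}(\mathbf{Acyc})$,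 $\nu(X)(A)=\mathbf{InvGraph}(A,X)$, is fully faithful; and for each involutive graph $X$, the composite functor $\nu G$ takes the canonical cocone with vertex $X$ on the projection $\mathbf{Acyc}/X\to\mathbf{InvGraph}$ (with component $h$ at $h:A\to X$) to a colimit cocone in $\mathrm{PSh}(\mathbf{Acyc})$. Moreover, Grothendieck's symmetric simplicial characterisation of groupoids holds: let $\Delta_{\mathrm{sym}}$ be the category with objects $[n]=\{0,\dots,n\}$, $n\ge 0$, and all maps between them as morphisms. The functor $N:\mathbf{Gpd}\to\mathrm{PSh}(\Delta_{\mathrm{sym}})$, where $N(C)_n$ is the set of functors to $C$ from the chaotic groupoid on $[n]$ (exactly one morphism between any two objects), is fully faithful, and a presheaf $X$ on $\Delta_{\mathrm{sym}}$ belongs to its essential image if and only if for each $n\ge 1$ the canonical map $$X_n\to X_1\times_{X_0}X_1\times_{X_0}\cdots\times_{X_0}X_1\quad(n\text{ factors}),$$ whose $i$-th component is induced by the map $[1]\to[n]$, $0\mapsto i$, $1\mapsto i+1$ ($0\le i<n$), is a bijection. -/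

import Mathlib

open CategoryTheory Opposite

universe u v w

/-! ### Dense generators and monads with arities -/

section Arities

variable {E : Type w} [Category.{v} E]

/-- The nerve functor `ν_A : E ⥤ PSh(A)`, `X ↦ E(i_A(-), X)`, of the full subcategory of `E`
spanned by the objects satisfying `A`. -/
abbrev arityNerve (A : ObjectProperty E) : E ⥤ (A.FullSubcategoryᵒᵖ ⥤ Type v) :=
  yoneda ⋙ (Functor.whiskeringLeft _ _ (Type v)).obj A.ι.op

/-- The full subcategory spanned by the objects satisfying `A` is a dense generator of `E`:
it is small (up to equivalence) and its nerve functor is fully faithful. -/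
structure IsDenseGenerator (A : ObjectProperty E) : Prop where
  essentiallySmall : EssentiallySmall.{v} A.FullSubcategory
  full : (arityNerve A).Full
  faithful : (arityNerve A).Faithful

/-- The `A`-cocone over `X`: the projection functor `A/X ⥤ E`, `(a, f : a ⟶ X) ↦ a`, with
its tautological cocone of vertex `X`, whose component at `(a, f)` is `f`. -/
def arityCocone (A : ObjectProperty E) (X : E) :
    Limits.Cocone (CostructuredArrow.proj A.ι X ⋙ A.ι) where
  pt := X
  ι :=
    { app := fun f => f.hom
      naturality := fun f _ k => (CostructuredArrow.w k).trans (Category.comp_id f.hom).symm }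

/-- `T` is a monad with arities `A`: the objects satisfying `A` span a dense generator, and the
composite functor `ν_A T` takes the `A`-cocones in `E` to colimit cocones in `PSh(A)`. -/
structure HasArities (T : Monad E) (A : ObjectProperty E) : Prop where
  isDenseGenerator : IsDenseGenerator A
  isColimit : ∀ X : E,
    Nonempty (Limits.IsColimit ((T.toFunctor ⋙ arityNerve A).mapCocone (arityCocone A X)))

end Arities

/-! ### Involutive graphs -/

/-- An involutive graph: vertices, edges, source, target, and an involution on edges which
exchanges source and target. -/
structure InvGraph : Type (u + 1) where
  V : Type u
  E : Type u
  s : E → V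
  t : E → V
  inv : E → E
  inv_inv : ∀ e, inv (inv e) = e
  s_inv : ∀ e, s (inv e) = t e

namespace InvGraph

theorem t_inv (X : InvGraph.{u}) (e : X.E) : X.t (X.inv e) = X.s e := by
  rw [← X.s_inv, X.inv_inv]

/-- Morphisms of involutive graphs. -/
@[ext]
structure Hom (X Y : InvGraph.{u}) : Type u where
  onV : X.V → Y.V
  onE : X.E → Y.E
  s_comm : ∀ e, Y.s (onE e) = onV (X.s e)
  t_comm : ∀ e, Y.t (onE e) = onV (X.t e)
  inv_comm : ∀ e, onE (X.inv e) = Y.inv (onE e)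

instance : Category InvGraph.{u} where
  Hom X Y := Hom X Y
  id X := ⟨id, id, fun _ => rfl, fun _ => rfl, fun _ => rfl⟩
  comp f g := ⟨g.onV ∘ f.onV, g.onE ∘ f.onE,
    fun e => by simp [g.s_comm, f.s_comm], fun e => by simp [g.t_comm, f.t_comm],
    fun e => by simp [g.inv_comm, f.inv_comm]⟩

@[ext]
theorem hom_ext {X Y : InvGraph.{u}} {f g : X ⟶ Y} (hV : ∀ x, f.onV x = g.onV x)
    (hE : ∀ e, f.onE e = g.onE e) : f = g :=
  Hom.ext (funext hV) (funext hE)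

/-- The involutive graph associated with a combinatorial graph: a unique edge `a ⟶ b` for each
ordered pair `(a, b)` of adjacent vertices. -/
def ofSimpleGraph {V : Type u} (G : SimpleGraph V) : InvGraph.{u} where
  V := V
  E := { p : V × V // G.Adj p.1 p.2 }
  s p := p.1.1
  t p := p.1.2
  inv p := ⟨(p.1.2, p.1.1), p.2.symm⟩
  inv_inv _ := rfl
  s_inv _ := rfl

/-- The finite connected acyclic graphs, viewed as involutive graphs. (`SimpleGraph.IsTree` means
connected, in particular non-empty, and acyclic.) -/
def isAcyc : ObjectProperty InvGraph.{u} := fun X =>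
  ∃ (V : Type u) (G : SimpleGraph V), Finite V ∧ G.IsTree ∧ Nonempty (X ≅ ofSimpleGraph G)

/-- The underlying involutive graph of a groupoid: vertices are objects, edges are morphisms, and
the involution is `f ↦ f⁻¹`. -/
abbrev ofGroupoid (C : Type u) [Groupoid.{u} C] : InvGraph.{u} where
  V := C
  E := (a : C) × (b : C) × (a ⟶ b)
  s e := e.1
  t e := e.2.1
  inv e := ⟨e.2.1, e.1, Groupoid.inv e.2.2⟩
  inv_inv e := by simp
  s_inv _ := rfl

/-- The forgetful functor from groupoids to involutive graphs. -/
def forgetGrpd : Grpd.{u, u} ⥤ InvGraph.{u} where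
  obj C := ofGroupoid C
  map {C D} F :=
    { onV := fun x => (show C ⥤ D from F).obj x
      onE := fun e => ⟨_, _, (show C ⥤ D from F).map e.2.2⟩
      s_comm := fun _ => rfl
      t_comm := fun _ => rfl
      inv_comm := fun e => by simp [ofGroupoid] }
  map_id _ := rfl
  map_comp _ _ := rfl

/-! ### The free groupoid on an involutive graph -/

/-- The vertices of an involutive graph, regarded as a quiver. -/
def Vert (X : InvGraph.{u}) : Type u := X.V

/-- The edges `a ⟶ b` of an involutive graph. -/
instance (X : InvGraph.{u}) : Quiver.{u} X.Vert where
  Hom a b := { e : X.E // X.s e = a ∧ X.t e = b }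

/-- An edge as a morphism of the quiver of vertices. -/
def edge (X : InvGraph.{u}) (e : X.E) :
    @Quiver.Hom X.Vert _ (show X.Vert from X.s e) (show X.Vert from X.t e) :=
  ⟨e, rfl, rfl⟩

/-- The dual `b ⟶ a` of an edge `a ⟶ b`. -/
def dual {X : InvGraph.{u}} {a b : X.Vert} (f : a ⟶ b) : b ⟶ a :=
  ⟨X.inv f.1, (X.s_inv f.1).trans f.2.2, (X.t_inv f.1).trans f.2.1⟩

theorem dual_dual {X : InvGraph.{u}} {a b : X.Vert} (f : a ⟶ b) : dual (dual f) = f :=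
  Subtype.ext (X.inv_inv f.1)

/-- The path of length one given by an edge. -/
def single {X : InvGraph.{u}} {a b : X.Vert} (f : a ⟶ b) :
    (Paths.of X.Vert).obj a ⟶ (Paths.of X.Vert).obj b :=
  (Paths.of X.Vert).map f

/-- The relation on paths which removes a redundancy: an edge followed by its dual. -/
inductive redundancy (X : InvGraph.{u}) : HomRel (Paths X.Vert)
  | step (a b : X.Vert) (f : a ⟶ b) : redundancy X (single f ≫ single (dual f)) (𝟙 _)

/-- The free groupoid on an involutive graph: vertices as objects, paths modulo redundancies as
morphisms. -/
abbrev FreeGpd (X : InvGraph.{u}) : Type u := CategoryTheory.Quotient (redundancy X)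

/-- The vertex `a` as an object of the free groupoid. -/
abbrev vtx {X : InvGraph.{u}} (a : X.Vert) : FreeGpd X :=
  (CategoryTheory.Quotient.functor (redundancy X)).obj ((Paths.of X.Vert).obj a)

/-- The class of a path of length one. -/
def cls {X : InvGraph.{u}} {a b : X.Vert} (f : a ⟶ b) : vtx a ⟶ vtx b :=
  (CategoryTheory.Quotient.functor (redundancy X)).map (single f)

theorem cls_dual {X : InvGraph.{u}} {a b : X.Vert} (f : a ⟶ b) : cls f ≫ cls (dual f) = 𝟙 _ :=
  CategoryTheory.Quotient.sound _ (redundancy.step a b f)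

theorem dual_cls {X : InvGraph.{u}} {a b : X.Vert} (f : a ⟶ b) : cls (dual f) ≫ cls f = 𝟙 _ := by
  have := cls_dual (dual f)
  rwa [dual_dual] at this

theorem isIso_path {X : InvGraph.{u}} {a b : Paths X.Vert} (p : a ⟶ b) :
    IsIso ((CategoryTheory.Quotient.functor (redundancy X)).map p) := by
  induction p using Paths.induction with
  | id => infer_instance
  | comp p q ih =>
    rw [Functor.map_comp]
    have : IsIso ((CategoryTheory.Quotient.functor (redundancy X)).map ((Paths.of X.Vert).map q)) :=
      ⟨cls (dual q), cls_dual q, dual_cls q⟩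
    infer_instance

noncomputable instance (X : InvGraph.{u}) : Groupoid.{u} (FreeGpd X) :=
  Groupoid.ofIsIso fun f => by
    obtain ⟨p, rfl⟩ := (CategoryTheory.Quotient.functor (redundancy X)).map_surjective f
    exact isIso_path p

section Lift

variable {X : InvGraph.{u}} {C : Type u} [Groupoid.{u} C]

/-- The value at the edge `f : a ⟶ b` of a morphism from `X` to the underlying involutive graph
of a groupoid, as a morphism of that groupoid. -/
def valueAt (φ : X ⟶ ofGroupoid C) {a b : X.Vert} (f : a ⟶ b) :
    @Quiver.Hom C _ (φ.onV a) (φ.onV b) :=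
  eqToHom ((congrArg φ.onV f.2.1).symm.trans (φ.s_comm f.1).symm) ≫ (φ.onE f.1).2.2 ≫
    eqToHom ((φ.t_comm f.1).trans (congrArg φ.onV f.2.2))

theorem ofGroupoid_mk_eq (e : (ofGroupoid C).E) {a b : C} (ha : a = e.1) (hb : e.2.1 = b) :
    (⟨a, b, eqToHom ha ≫ e.2.2 ≫ eqToHom hb⟩ : (ofGroupoid C).E) = e := by
  subst ha hb
  simp

theorem ofGroupoid_inj {a b : C} {f g : a ⟶ b}
    (h : (⟨a, b, f⟩ : (ofGroupoid C).E) = ⟨a, b, g⟩) : f = g :=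
  eq_of_heq (Sigma.mk.inj (eq_of_heq (Sigma.mk.inj h).2)).2

theorem valueAt_mk (φ : X ⟶ ofGroupoid C) {a b : X.Vert} (f : a ⟶ b) :
    (⟨φ.onV a, φ.onV b, valueAt φ f⟩ : (ofGroupoid C).E) = φ.onE f.1 :=
  ofGroupoid_mk_eq _ _ _

theorem valueAt_unique (φ : X ⟶ ofGroupoid C) {a b : X.Vert} (f : a ⟶ b)
    (g : @Quiver.Hom C _ (φ.onV a) (φ.onV b))
    (h : (⟨φ.onV a, φ.onV b, g⟩ : (ofGroupoid C).E) = φ.onE f.1) : valueAt φ f = g :=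
  ofGroupoid_inj ((valueAt_mk φ f).trans h.symm)

theorem valueAt_dual (φ : X ⟶ ofGroupoid C) {a b : X.Vert} (f : a ⟶ b) :
    valueAt φ (dual f) = Groupoid.inv (valueAt φ f) :=
  valueAt_unique φ _ _
    ((congrArg (ofGroupoid C).inv (valueAt_mk φ f)).trans (φ.inv_comm f.1).symm)

/-- The functor out of the free groupoid induced by a morphism of involutive graphs. -/
def liftFree (φ : X ⟶ ofGroupoid C) : FreeGpd X ⥤ C :=
  CategoryTheory.Quotient.lift (redundancy X)
    (Paths.lift { obj := fun a => (φ.onV a : C), map := fun f => valueAt φ f })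
    (by
      rintro _ _ _ _ ⟨a, b, f⟩
      refine (Functor.map_comp _ _ _).trans ?_
      refine (congrArg₂ _ (Paths.lift_toPath _ f) (Paths.lift_toPath _ (dual f))).trans ?_
      refine (congrArg _ (valueAt_dual φ f)).trans ?_
      exact (Groupoid.comp_inv _).trans (CategoryTheory.Functor.map_id _ _).symm)

theorem liftFree_cls (φ : X ⟶ ofGroupoid C) {a b : X.Vert} (f : a ⟶ b) :
    (liftFree φ).map (cls f) = valueAt φ f :=
  Paths.lift_toPath _ f

theorem map_cls_dual (F : FreeGpd X ⥤ C) {a b : X.Vert} (f : a ⟶ b) :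
    F.map (cls (dual f)) = Groupoid.inv (F.map (cls f)) := by
  rw [Groupoid.inv_eq_inv]
  apply IsIso.eq_inv_of_hom_inv_id
  rw [← F.map_comp, cls_dual, F.map_id]

theorem map_cls_edge (F : FreeGpd X ⥤ C) {a b : X.Vert} (f : a ⟶ b) :
    (⟨_, _, F.map (cls (X.edge f.1))⟩ : (ofGroupoid C).E) = ⟨_, _, F.map (cls f)⟩ := by
  obtain ⟨f, rfl, rfl⟩ := f
  rfl

/-- The restriction to the edges of a functor out of the free groupoid. -/
def restrictFree (F : FreeGpd X ⥤ C) : X ⟶ ofGroupoid C where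
  onV a := F.obj (vtx (show X.Vert from a))
  onE e := ⟨_, _, F.map (cls (X.edge e))⟩
  s_comm _ := rfl
  t_comm _ := rfl
  inv_comm e := (map_cls_edge F (dual (X.edge e))).trans
    (congrArg (fun g => (⟨_, _, g⟩ : (ofGroupoid C).E)) (map_cls_dual F (X.edge e)))

theorem restrictFree_liftFree (φ : X ⟶ ofGroupoid C) : restrictFree (liftFree φ) = φ := by
  refine hom_ext (fun _ => rfl) (fun e => ?_)
  refine Eq.trans ?_ (valueAt_mk φ (X.edge e))
  exact congrArg (fun g => (⟨_, _, g⟩ : (ofGroupoid C).E)) (liftFree_cls φ _)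

theorem liftFree_restrictFree (F : FreeGpd X ⥤ C) : liftFree (restrictFree F) = F := by
  refine CategoryTheory.Quotient.lift_unique' _ _ _ (Paths.ext_functor rfl ?_)
  intro a b f
  refine Eq.trans (b := F.map (cls f)) ?_ ((Category.id_comp _).trans (Category.comp_id _)).symm
  refine (liftFree_cls (restrictFree F) f).trans ?_
  exact valueAt_unique _ _ _ (map_cls_edge F f).symm

end Lift

/-- Functors out of the free groupoid correspond to morphisms of involutive graphs. -/
noncomputable def freeEquiv (X : InvGraph.{u}) (C : Grpd.{u, u}) :
    (Grpd.of (FreeGpd X) ⟶ C) ≃ (X ⟶ forgetGrpd.obj C) where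
  toFun F := restrictFree (show FreeGpd X ⥤ C from F)
  invFun φ := liftFree φ
  left_inv F := liftFree_restrictFree F
  right_inv φ := restrictFree_liftFree φ

/-- The free groupoid functor. -/
noncomputable def freeGrpd : InvGraph.{u} ⥤ Grpd.{u, u} :=
  Adjunction.leftAdjointOfEquiv freeEquiv (fun _ _ _ _ _ => rfl)

/-- The free groupoid functor is left adjoint to the forgetful functor. -/
noncomputable def freeGrpdAdj : freeGrpd.{u} ⊣ forgetGrpd.{u} :=
  Adjunction.adjunctionOfEquivLeft freeEquiv (fun _ _ _ _ _ => rfl)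

/-- The free groupoid monad `G` on involutive graphs. -/
noncomputable def freeGroupoidMonad : Monad InvGraph.{u} :=
  freeGrpdAdj.toMonad

end InvGraph

/-! ### Symmetric simplicial sets -/

/-- The category `Δ_sym` of the non-empty finite sets `[n] = {0, ..., n}` and all maps. -/
structure SymSimplex : Type where
  len : ℕ

namespace SymSimplex

instance : Category SymSimplex where
  Hom m n := Fin (m.len + 1) → Fin (n.len + 1)
  id _ := id
  comp f g := g ∘ f

/-- The morphism of `Δ_sym` given by a map. -/
def ofFun {m n : ℕ} (f : Fin (m + 1) → Fin (n + 1)) : SymSimplex.mk m ⟶ SymSimplex.mk n := f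

/-- The chaotic category on `[n]`. -/
abbrev Chaotic (n : SymSimplex) : Type := Codiscrete (Fin (n.len + 1))

/-- The functor between chaotic categories with given object map. -/
abbrev chaoticMap {m n : SymSimplex} (f : m ⟶ n) : Chaotic m ⥤ Chaotic n :=
  Codiscrete.functorOfFun f

end SymSimplex

/-- The symmetric nerve of a groupoid `C`: its value at `[n]` is the set of functors from the
chaotic groupoid on `[n]` to `C`. -/
def symNerveObj (C : Grpd.{u, u}) : SymSimplexᵒᵖ ⥤ Type u where
  obj n := SymSimplex.Chaotic n.unop ⥤ C
  map f := ↾fun x => SymSimplex.chaoticMap f.unop ⋙ x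

/-- The symmetric nerve functor from groupoids to symmetric simplicial sets. -/
def symNerve : Grpd.{u, u} ⥤ (SymSimplexᵒᵖ ⥤ Type u) where
  obj C := symNerveObj C
  map {C D} F := { app := fun n => ↾fun x : SymSimplex.Chaotic n.unop ⥤ C => x ⋙ F }

/-- The Grothendieck-Segal condition on a symmetric simplicial set `X`: for `n ≥ 1`, an `n`-simplex
is the same thing as a string of `n` composable `1`-simplices, i.e. the canonical map
`X_n → X_1 ×_{X_0} ⋯ ×_{X_0} X_1` is a bijection. -/
def SymSegal (X : SymSimplexᵒᵖ ⥤ Type u) : Prop :=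
  ∀ (n : ℕ), 1 ≤ n → ∀ e : Fin n → X.obj (op ⟨1⟩),
    (∀ i j : Fin n, (i : ℕ) + 1 = j →
      X.map (SymSimplex.ofFun (m := 0) (n := 1) fun _ => 1).op (e i) =
        X.map (SymSimplex.ofFun (m := 0) (n := 1) fun _ => 0).op (e j)) →
    ∃! x : X.obj (op ⟨n⟩), ∀ i : Fin n,
      X.map (SymSimplex.ofFun (m := 1) (n := n) ![i.castSucc, i.succ]).op x = e i

/-!
**Arities.** Trees are a dense generator because a vertex or an edge of an involutive graph is a
morphism from the tree with one vertex or one edge.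

For a tree `A`, the free groupoid on `A` is chaotic (`chaotic_freeGpd_ofSimpleGraph`), so a morphism
`A ⟶ G X`, that is, a functor `Φ` from this groupoid to the free groupoid on `X`, amounts to a base
vertex `x` and, for each vertex of `A`, a morphism of the free groupoid out of `x`. Such morphisms
are the vertices of the universal cover of `X` (`coverGraph`), which is connected, and acyclic by
the normal form theorem: the free groupoid acts on reduced words (`wordAction`), and the length of
the reduced word of a vertex serves as its distance to the base vertex. Any finite set of vertices of
the universal cover lies in a finite subtree `T`, which maps to `X`; this factors `Φ` through `G T`
(`exists_factor`). Conversely, if `Φ` factors through `G B` for some tree `B` over `X`, then `B`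
lifts to the universal cover, and maps to every subtree `T` that is large enough, compatibly with
the factorizations of `Φ` (`exists_lift`). Two factorizations therefore have a common image in a finite
subtree (`exists_common_factor`). This says that the canonical cocone is, at each `A`, jointly
surjective, and that two elements with the same image already agree at some object of the diagram,
hence that it is a colimit cocone.

**Symmetric simplicial sets.** A functor from a chaotic groupoid on `[n]` is determined by its
values on the consecutive morphisms, and these can be prescribed, which gives the Segal condition
for nerves. Full faithfulness uses only simplices of dimension at most `2`. Conversely, if `X`
satisfies the Segal condition, then edges compose by filling triangles; a composite can be computed
in any simplex containing the two edges (`SymSegal.comp_eq`), so that associativity comes from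
`X_3`, and inverses from the symmetry of `[1]`. Sending an `n`-simplex to its vertices and edges
identifies `X` with the nerve of this groupoid (`SymSegal.isoSymNerve`), as both sides are strings
of `n` composable edges.
-/

/-! ### Functors from codiscrete categories to groupoids -/

namespace CategoryTheory.Codiscrete

variable {A : Type w} {C : Type u} [Groupoid.{v} C]

/-- The functor from a codiscrete category to a groupoid determined by a star: a base object `z`
and a morphism from `z` to each value. -/
def ofStar (c : A → C) {z : C} (p : ∀ i, z ⟶ c i) : Codiscrete A ⥤ C where
  obj i := c i.as
  map {i j} _ := Groupoid.inv (p i.as) ≫ p j.as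
  map_id _ := by simp
  map_comp _ _ := by simp

theorem map_iso_trans {D : Type u} [Category.{v} D] (x : Codiscrete A ⥤ D) (i j k : Codiscrete A) :
    x.map (iso i j).hom ≫ x.map (iso j k).hom = x.map (iso i k).hom :=
  (x.map_comp _ _).symm

theorem map_iso_self {D : Type u} [Category.{v} D] (x : Codiscrete A ⥤ D) (i : Codiscrete A) :
    x.map (iso i i).hom = 𝟙 _ :=
  x.map_id _

/-- Functors from the codiscrete category on `{0, ..., n}` to a groupoid are determined by their
values on the objects and on the morphisms `i ⟶ i + 1`. -/
theorem functor_ext_succ {n : ℕ} {x y : Codiscrete (Fin (n + 1)) ⥤ C}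
    (hobj : ∀ i, x.obj i = y.obj i)
    (hmap : ∀ i : Fin n, x.map (iso ⟨i.castSucc⟩ ⟨i.succ⟩).hom =
      eqToHom (hobj _) ≫ y.map (iso ⟨i.castSucc⟩ ⟨i.succ⟩).hom ≫ eqToHom (hobj _).symm) :
    x = y := by
  have h0 : ∀ i : Fin (n + 1), x.map (iso ⟨0⟩ ⟨i⟩).hom =
      eqToHom (hobj _) ≫ y.map (iso ⟨0⟩ ⟨i⟩).hom ≫ eqToHom (hobj _).symm := by
    intro i
    induction i using Fin.induction with
    | zero => simp [map_iso_self]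
    | succ i ih =>
      rw [← map_iso_trans x _ ⟨i.castSucc⟩, ← map_iso_trans y _ ⟨i.castSucc⟩, ih, hmap]
      simp
  refine Functor.ext hobj ?_
  rintro ⟨i⟩ ⟨j⟩ f
  obtain rfl : f = (iso _ _).hom := rfl
  rw [← cancel_epi (x.map (iso ⟨0⟩ ⟨i⟩).hom), map_iso_trans, h0, h0]
  simp [← map_iso_trans y ⟨0⟩ ⟨i⟩ ⟨j⟩]

end CategoryTheory.Codiscrete

namespace SymSimplex

open Codiscrete

/-! ### The symmetric nerve of a groupoid -/

theorem chaoticMap_comp_eq_iff {C : Type u} [Groupoid.{u} C] {n : ℕ} (i j : Fin (n + 1))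
    (x : Codiscrete (Fin (n + 1)) ⥤ C) (y : Codiscrete (Fin 2) ⥤ C) :
    Codiscrete.functorOfFun ![i, j] ⋙ x = y ↔
      ∃ (hi : x.obj ⟨i⟩ = y.obj ⟨0⟩) (hj : x.obj ⟨j⟩ = y.obj ⟨1⟩),
        x.map (iso ⟨i⟩ ⟨j⟩).hom = eqToHom hi ≫ y.map (iso ⟨0⟩ ⟨1⟩).hom ≫ eqToHom hj.symm := by
  constructor
  · rintro rfl
    exact ⟨rfl, rfl, by simp [Codiscrete.functorOfFun, Codiscrete.functor]; rfl⟩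
  · rintro ⟨hi, hj, h⟩
    have hobj : ∀ k, (Codiscrete.functorOfFun ![i, j] ⋙ x).obj k = y.obj k := by
      rintro ⟨k⟩
      fin_cases k
      exacts [hi, hj]
    refine functor_ext_succ hobj fun k => ?_
    fin_cases k
    exact h

/-- The nerve of a groupoid satisfies the Segal condition: a string of `n` morphisms has a unique
extension to the chaotic groupoid on `[n]`, as morphisms are invertible. -/
theorem symSegal_symNerveObj (C : Grpd.{u, u}) : SymSegal (symNerveObj C) := by
  intro n hn e he
  obtain ⟨n, rfl⟩ := Nat.exists_eq_add_of_le' hn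
  change Fin (n + 1) → (Codiscrete (Fin 2) ⥤ C) at e
  have he' : ∀ i j : Fin (n + 1), (i : ℕ) + 1 = j → (e i).obj ⟨1⟩ = (e j).obj ⟨0⟩ :=
    fun i j h => Functor.congr_obj (he i j h) ⟨0⟩
  change ∃! x : Codiscrete (Fin (n + 2)) ⥤ C,
    ∀ i : Fin (n + 1), Codiscrete.functorOfFun ![i.castSucc, i.succ] ⋙ x = e i
  simp only [chaoticMap_comp_eq_iff]
  -- With this choice of objects, the target of each `c i.castSucc ⟶ c i.succ` is the target of
  -- `e i` by definition; sources agree by the matching condition.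
  let c : Fin (n + 2) → C := Fin.cons ((e 0).obj ⟨0⟩) (fun i => (e i).obj ⟨1⟩)
  have hc : ∀ i : Fin (n + 1), c i.castSucc = (e i).obj ⟨0⟩ := by
    intro i
    induction i using Fin.cases with
    | zero => rfl
    | succ i => exact he' i.castSucc i.succ (by simp)
  have hc' : ∀ i : Fin (n + 1), c i.succ = (e i).obj ⟨1⟩ := fun i => rfl
  let Q := ComposableArrows.mkOfObjOfMapSucc c fun i =>
    eqToHom (hc i) ≫ (e i).map (iso ⟨0⟩ ⟨1⟩).hom ≫ eqToHom (hc' i).symm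
  have hQ : ∀ i : Fin (n + 1), Q.map (homOfLE (Fin.castSucc_lt_succ (i := i)).le) =
      eqToHom (hc i) ≫ (e i).map (iso ⟨0⟩ ⟨1⟩).hom ≫ eqToHom (hc' i).symm :=
    fun i => ComposableArrows.mkOfObjOfMapSucc_map_succ c _ i.1 i.2
  refine existsUnique_of_exists_of_unique
    ⟨ofStar c (z := c 0) fun i => Q.map (homOfLE (Fin.zero_le i)), fun i => ⟨hc i, rfl, ?_⟩⟩ ?_
  · refine Eq.trans ?_ (hQ i)
    change Groupoid.inv (Q.map _) ≫ Q.map _ = _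
    rw [Groupoid.inv_eq_inv, IsIso.inv_comp_eq, ← Q.map_comp]
    rfl
  · intro y y' hy hy'
    have hobj : ∀ k, y.obj k = y'.obj k := by
      rintro ⟨k⟩
      induction k using Fin.cases with
      | zero => exact (hy 0).1.trans (hy' 0).1.symm
      | succ k => exact (hy k).2.1.trans (hy' k).2.1.symm
    refine functor_ext_succ hobj fun i => ?_
    obtain ⟨h0, h1, h⟩ := hy i
    obtain ⟨h0', h1', h'⟩ := hy' i
    rw [h, h']
    simp

/-! ### The symmetric nerve is fully faithful -/

section FullyFaithful

variable {C D : Type u} [Groupoid.{u} C] [Groupoid.{u} D]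

/-- The functor from the codiscrete category on `{0, 1}` classifying a morphism. -/
def classify {a b : C} (f : a ⟶ b) : Codiscrete (Fin 2) ⥤ C :=
  ofStar ![a, b] (z := a) (Fin.cases (𝟙 a) (Fin.cases f (fun i => i.elim0)))

theorem classify_map {a b : C} (f : a ⟶ b) : (classify f).map (iso ⟨0⟩ ⟨1⟩).hom = f := by
  change Groupoid.inv (𝟙 a) ≫ f = f
  simp

/-- The functor from the codiscrete category on `{0}` classifying an object. -/
def classifyObj (a : C) : Codiscrete (Fin 1) ⥤ C :=
  ofStar (fun _ => a) (fun _ => 𝟙 a)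

theorem functorOfFun_comp_eq_classifyObj {n : ℕ} (i : Fin (n + 1))
    (x : Codiscrete (Fin (n + 1)) ⥤ C) :
    Codiscrete.functorOfFun (fun _ => i) ⋙ x = classifyObj (x.obj ⟨i⟩) :=
  functor_ext_succ (fun _ => rfl) fun i => i.elim0

theorem functorOfFun_comp_eq_classify {n : ℕ} (i j : Fin (n + 1))
    (x : Codiscrete (Fin (n + 1)) ⥤ C) :
    Codiscrete.functorOfFun ![i, j] ⋙ x = classify (x.map (iso ⟨i⟩ ⟨j⟩).hom) := by
  rw [chaoticMap_comp_eq_iff]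
  refine ⟨rfl, rfl, ?_⟩
  rw [classify_map]
  exact ((Category.id_comp _).trans (Category.comp_id _)).symm

variable (T : ∀ n : ℕ, (Codiscrete (Fin (n + 1)) ⥤ C) → (Codiscrete (Fin (n + 1)) ⥤ D))
  (hT : ∀ {m n : ℕ} (g : Fin (m + 1) → Fin (n + 1)) (x : Codiscrete (Fin (n + 1)) ⥤ C),
    T m (Codiscrete.functorOfFun g ⋙ x) = Codiscrete.functorOfFun g ⋙ T n x)

theorem eqToHom_comp_comp_eqToHom_trans {a a' a'' b b' b'' : C} (f : a'' ⟶ b'') (ha : a = a')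
    (ha' : a' = a'') (hb' : b'' = b') (hb : b' = b) :
    eqToHom (ha.trans ha') ≫ f ≫ eqToHom (hb'.trans hb) =
      eqToHom ha ≫ (eqToHom ha' ≫ f ≫ eqToHom hb') ≫ eqToHom hb := by
  subst ha ha' hb' hb
  simp

include hT in
theorem obj_eq_of_natural {n : ℕ} (x : Codiscrete (Fin (n + 1)) ⥤ C) (i : Fin (n + 1)) :
    (T _ x).obj ⟨i⟩ = (T _ (classifyObj (x.obj ⟨i⟩))).obj ⟨0⟩ := by
  rw [← functorOfFun_comp_eq_classifyObj, hT]
  rfl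

/-- The action on morphisms of the functor induced by a natural family of maps between symmetric
nerves. -/
def mapOfNatural {a b : C} (f : a ⟶ b) :
    (T _ (classifyObj a)).obj ⟨0⟩ ⟶ (T _ (classifyObj b)).obj ⟨0⟩ :=
  eqToHom (obj_eq_of_natural T hT (classify f) 0).symm ≫
    (T _ (classify f)).map (iso ⟨0⟩ ⟨1⟩).hom ≫ eqToHom (obj_eq_of_natural T hT (classify f) 1)

theorem map_eq_of_natural {n : ℕ} (x : Codiscrete (Fin (n + 1)) ⥤ C) (i j : Fin (n + 1)) :
    (T _ x).map (iso ⟨i⟩ ⟨j⟩).hom = eqToHom (obj_eq_of_natural T hT x i) ≫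
      mapOfNatural T hT (x.map (iso ⟨i⟩ ⟨j⟩).hom) ≫
        eqToHom (obj_eq_of_natural T hT x j).symm := by
  have h := hT ![i, j] x
  rw [functorOfFun_comp_eq_classify] at h
  obtain ⟨_, _, h⟩ := (chaoticMap_comp_eq_iff i j _ _).1 h.symm
  rw [h]
  exact eqToHom_comp_comp_eqToHom_trans _ _ _ _ _

include hT in
theorem obj_eq_of_natural_of_eq {n : ℕ} (x : Codiscrete (Fin (n + 1)) ⥤ C) (i : Fin (n + 1))
    {a : C} (ha : x.obj ⟨i⟩ = a) : (T _ (classifyObj a)).obj ⟨0⟩ = (T _ x).obj ⟨i⟩ := by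
  subst ha
  exact (obj_eq_of_natural T hT x i).symm

theorem mapOfNatural_of_eq {n : ℕ} (x : Codiscrete (Fin (n + 1)) ⥤ C) (i j : Fin (n + 1))
    {a b : C} (f : a ⟶ b) (ha : x.obj ⟨i⟩ = a) (hb : x.obj ⟨j⟩ = b)
    (hf : x.map (iso ⟨i⟩ ⟨j⟩).hom = eqToHom ha ≫ f ≫ eqToHom hb.symm) :
    mapOfNatural T hT f = eqToHom (obj_eq_of_natural_of_eq T hT x i ha) ≫
      (T _ x).map (iso ⟨i⟩ ⟨j⟩).hom ≫ eqToHom (obj_eq_of_natural_of_eq T hT x j hb).symm := by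
  subst ha hb
  obtain rfl : x.map (iso ⟨i⟩ ⟨j⟩).hom = f := by simpa using hf
  rw [map_eq_of_natural T hT]
  simp

/-- The functor induced by a natural family of maps between symmetric nerves. -/
def functorOfNatural : C ⥤ D where
  obj a := (T _ (classifyObj a)).obj ⟨0⟩
  map f := mapOfNatural T hT f
  map_id a := by
    rw [mapOfNatural_of_eq T hT (classifyObj a) 0 0 (𝟙 a) rfl rfl
      ((map_iso_self _ _).trans ((Category.id_comp _).trans (Category.comp_id _)).symm),
      map_iso_self]
    simp
  map_comp {a b c} f g := by
    let x : Codiscrete (Fin 3) ⥤ C := ofStar ![a, b, c] (z := a)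
      (Fin.cases (𝟙 a) (Fin.cases f (Fin.cases (f ≫ g) (fun i => i.elim0))))
    have h01 : x.map (iso ⟨0⟩ ⟨1⟩).hom = 𝟙 _ ≫ f ≫ 𝟙 _ := by
      refine Eq.trans ?_ ((Category.id_comp _).trans (Category.comp_id _)).symm
      change Groupoid.inv (𝟙 a) ≫ f = f
      simp
    have h12 : x.map (iso ⟨1⟩ ⟨2⟩).hom = 𝟙 _ ≫ g ≫ 𝟙 _ := by
      refine Eq.trans ?_ ((Category.id_comp _).trans (Category.comp_id _)).symm
      change Groupoid.inv f ≫ f ≫ g = g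
      simp
    have h02 : x.map (iso ⟨0⟩ ⟨2⟩).hom = 𝟙 _ ≫ (f ≫ g) ≫ 𝟙 _ := by
      refine Eq.trans ?_ ((Category.id_comp _).trans (Category.comp_id _)).symm
      change Groupoid.inv (𝟙 a) ≫ f ≫ g = f ≫ g
      simp
    rw [mapOfNatural_of_eq T hT x 0 1 f rfl rfl h01, mapOfNatural_of_eq T hT x 1 2 g rfl rfl h12,
      mapOfNatural_of_eq T hT x 0 2 (f ≫ g) rfl rfl h02, ← map_iso_trans (T _ x) ⟨0⟩ ⟨1⟩ ⟨2⟩]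
    simp

/-- A natural family of maps between symmetric nerves is composition with the functor it induces,
which is why the symmetric nerve is full. -/
theorem comp_functorOfNatural {n : ℕ} (x : Codiscrete (Fin (n + 1)) ⥤ C) :
    x ⋙ functorOfNatural T hT = T _ x :=
  (CategoryTheory.Functor.ext (fun i => obj_eq_of_natural T hT x i.as)
    fun i j _ => map_eq_of_natural T hT x i.as j.as).symm

end FullyFaithful

instance symNerve_full : symNerve.{u}.Full where
  map_surjective {C D} τ := by
    let T : ∀ n : ℕ, (Codiscrete (Fin (n + 1)) ⥤ C) → (Codiscrete (Fin (n + 1)) ⥤ D) :=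
      fun n x => τ.app (op ⟨n⟩) x
    have hT : ∀ {m n : ℕ} (g : Fin (m + 1) → Fin (n + 1)) (x : Codiscrete (Fin (n + 1)) ⥤ C),
        T _ (Codiscrete.functorOfFun g ⋙ x) = Codiscrete.functorOfFun g ⋙ T _ x :=
      fun g x => ConcreteCategory.congr_hom (τ.naturality (ofFun g).op) x
    refine ⟨functorOfNatural T hT, ?_⟩
    ext n x
    exact comp_functorOfNatural T hT x

instance symNerve_faithful : symNerve.{u}.Faithful where
  map_injective {C D} F G h := by
    have key : ∀ {n : ℕ} (x : Codiscrete (Fin (n + 1)) ⥤ C), x ⋙ F = x ⋙ G := fun {n} x =>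
      ConcreteCategory.congr_hom (NatTrans.congr_app h (op ⟨n⟩)) x
    change (F : C ⥤ D) = (G : C ⥤ D)
    refine CategoryTheory.Functor.ext (fun a => Functor.congr_obj (key (classifyObj a)) ⟨0⟩)
      fun a b f => ?_
    have := Functor.congr_hom (key (classify f)) (iso ⟨0⟩ ⟨1⟩).hom
    exact (congrArg F.map (classify_map f).symm).trans (this.trans
      (congrArg (fun g => eqToHom _ ≫ G.map g ≫ eqToHom _) (classify_map f)))

/-! ### The groupoid of a symmetric simplicial set satisfying the Segal condition -/

section Segal

variable {X : SymSimplexᵒᵖ ⥤ Type u}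

/-- The action of a map `[m] → [n]` on the `n`-simplices of a symmetric simplicial set. -/
def res {m n : ℕ} (g : Fin (m + 1) → Fin (n + 1)) (x : X.obj (op ⟨n⟩)) : X.obj (op ⟨m⟩) :=
  X.map (ofFun g).op x

theorem res_res {l m n : ℕ} (f : Fin (l + 1) → Fin (m + 1)) (g : Fin (m + 1) → Fin (n + 1))
    (x : X.obj (op ⟨n⟩)) : res f (res g x) = res (g ∘ f) x :=
  (ConcreteCategory.congr_hom (X.map_comp (ofFun g).op (ofFun f).op) x).symm

theorem res_id {n : ℕ} (x : X.obj (op ⟨n⟩)) : res id x = x :=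
  ConcreteCategory.congr_hom (X.map_id (op ⟨n⟩)) x

/-- The `i`-th vertex of a simplex. -/
def vert {n : ℕ} (i : Fin (n + 1)) (x : X.obj (op ⟨n⟩)) : X.obj (op ⟨0⟩) :=
  res (fun _ : Fin 1 => i) x

/-- The edge of a simplex from its `i`-th to its `j`-th vertex. -/
def side {n : ℕ} (i j : Fin (n + 1)) (x : X.obj (op ⟨n⟩)) : X.obj (op ⟨1⟩) :=
  res (m := 1) ![i, j] x

theorem vert_res {m n : ℕ} (g : Fin (m + 1) → Fin (n + 1)) (i : Fin (m + 1))
    (x : X.obj (op ⟨n⟩)) : vert i (res g x) = vert (g i) x :=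
  res_res _ _ _

theorem side_res {m n : ℕ} (g : Fin (m + 1) → Fin (n + 1)) (i j : Fin (m + 1))
    (x : X.obj (op ⟨n⟩)) : side i j (res g x) = side (g i) (g j) x := by
  refine (res_res _ _ _).trans ?_
  congr 1
  funext k
  fin_cases k <;> rfl

theorem vert_zero_side {n : ℕ} (i j : Fin (n + 1)) (x : X.obj (op ⟨n⟩)) :
    vert 0 (side i j x) = vert i x :=
  vert_res (m := 1) _ _ _

theorem vert_one_side {n : ℕ} (i j : Fin (n + 1)) (x : X.obj (op ⟨n⟩)) :
    vert 1 (side i j x) = vert j x :=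
  vert_res (m := 1) _ _ _

theorem vert_one_eq_vert_zero {n : ℕ} {i j k : Fin (n + 1)} {x : X.obj (op ⟨n⟩)}
    {f g : X.obj (op ⟨1⟩)} (hf : side i j x = f) (hg : side j k x = g) : vert 1 f = vert 0 g := by
  rw [← hf, ← hg, vert_one_side, vert_zero_side]

theorem vert_eq_self (a : X.obj (op ⟨0⟩)) (i : Fin 1) : vert i a = a := by
  obtain rfl : i = 0 := Subsingleton.elim _ _
  refine Eq.trans ?_ (res_id a)
  exact congrArg (fun g => res g a) (funext fun k => Subsingleton.elim _ _)

theorem side_zero_one (f : X.obj (op ⟨1⟩)) : side 0 1 f = f := by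
  refine Eq.trans ?_ (res_id f)
  refine congrArg (fun g => res (m := 1) g f) (funext fun k => ?_)
  fin_cases k <;> rfl

theorem side_self {n : ℕ} (i : Fin (n + 1)) (x : X.obj (op ⟨n⟩)) :
    side i i x = side 0 0 (vert i x) := by
  exact (side_res (m := 0) (fun _ => i) 0 0 x).symm

end Segal

end SymSimplex

namespace SymSegal

open SymSimplex Codiscrete

section Segal

variable {X : SymSimplexᵒᵖ ⥤ Type u} (hX : SymSegal X)

include hX in
theorem ext_side {n : ℕ} {x y : X.obj (op ⟨n + 1⟩)}
    (h : ∀ i : Fin (n + 1), side i.castSucc i.succ x = side i.castSucc i.succ y) : x = y := by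
  refine (hX (n + 1) (by omega) (fun i => side i.castSucc i.succ y) ?_).unique h fun _ => rfl
  intro i j hij
  refine (vert_one_side _ _ y).trans (Eq.trans ?_ (vert_zero_side _ _ y).symm)
  congr 1
  exact Fin.ext hij

include hX in
theorem exists_side {n : ℕ} (e : Fin (n + 1) → X.obj (op ⟨1⟩))
    (he : ∀ i : Fin n, vert 1 (e i.castSucc) = vert 0 (e i.succ)) :
    ∃ x : X.obj (op ⟨n + 1⟩), ∀ i : Fin (n + 1), side i.castSucc i.succ x = e i := by
  refine (hX (n + 1) (by omega) e ?_).exists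
  intro i j hij
  have hi : (i : ℕ) < n := by omega
  obtain rfl : (⟨i, hi⟩ : Fin n).succ = j := Fin.ext hij
  exact he ⟨i, hi⟩

include hX in
theorem exists_triangle {f g : X.obj (op ⟨1⟩)} (h : vert 1 f = vert 0 g) :
    ∃ x : X.obj (op ⟨2⟩), side 0 1 x = f ∧ side 1 2 x = g := by
  obtain ⟨x, hx⟩ := hX.exists_side ![f, g] (by intro i; fin_cases i; exact h)
  exact ⟨x, hx 0, hx 1⟩

/-- The composite of two consecutive edges: the long side of the triangle they span. -/
noncomputable def comp (f g : X.obj (op ⟨1⟩)) (h : vert 1 f = vert 0 g) : X.obj (op ⟨1⟩) :=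
  side 0 2 (hX.exists_triangle h).choose

/-- Composition of edges can be computed in any simplex of which they are sides, not only in the
triangle they span. All the groupoid laws follow from this. -/
theorem comp_eq {n : ℕ} {i j k : Fin (n + 1)} (x : X.obj (op ⟨n⟩)) {f g : X.obj (op ⟨1⟩)}
    (hf : side i j x = f) (hg : side j k x = g) :
    hX.comp f g (vert_one_eq_vert_zero hf hg) = side i k x := by
  have h := vert_one_eq_vert_zero hf hg
  have : (hX.exists_triangle h).choose = res (m := 2) ![i, j, k] x := by
    refine hX.ext_side fun l => ?_
    have := (hX.exists_triangle h).choose_spec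
    rw [side_res]
    fin_cases l
    · exact this.1.trans hf.symm
    · exact this.2.trans hg.symm
  unfold comp
  rw [this, side_res]
  rfl

/-- The vertices of a symmetric simplicial set satisfying the Segal condition, as the objects of a
groupoid. -/
def Obj (_ : SymSegal X) : Type u := X.obj (op ⟨0⟩)

/-- Morphisms are edges, composed by filling triangles. -/
noncomputable instance : Groupoid.{u} hX.Obj where
  Hom a b := { f : X.obj (op ⟨1⟩) // vert 0 f = a ∧ vert 1 f = b }
  id a := ⟨side 0 0 (show X.obj (op ⟨0⟩) from a),
    (vert_zero_side _ _ _).trans (vert_eq_self _ _), (vert_one_side _ _ _).trans (vert_eq_self _ _)⟩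
  comp f g := ⟨hX.comp f.1 g.1 (f.2.2.trans g.2.1.symm), by
      obtain ⟨x, hf, hg⟩ := hX.exists_triangle (f.2.2.trans g.2.1.symm)
      rw [hX.comp_eq x hf hg, vert_zero_side, vert_one_side, ← vert_zero_side 0 1, hf,
        ← vert_one_side 1 2, hg]
      exact ⟨f.2.1, g.2.2⟩⟩
  inv f := ⟨side 1 0 f.1, (vert_zero_side _ _ _).trans f.2.2, (vert_one_side _ _ _).trans f.2.1⟩
  id_comp {a b} f := by
    obtain ⟨f, rfl, rfl⟩ := f
    exact Subtype.ext ((hX.comp_eq f (side_self _ _) (side_zero_one f)).trans (side_zero_one f))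
  comp_id {a b} f := by
    obtain ⟨f, rfl, rfl⟩ := f
    exact Subtype.ext ((hX.comp_eq f (side_zero_one f) (side_self _ _)).trans (side_zero_one f))
  inv_comp {a b} f := by
    obtain ⟨f, rfl, rfl⟩ := f
    exact Subtype.ext ((hX.comp_eq f rfl (side_zero_one f)).trans (side_self _ _))
  comp_inv {a b} f := by
    obtain ⟨f, rfl, rfl⟩ := f
    exact Subtype.ext ((hX.comp_eq f (side_zero_one f) rfl).trans (side_self _ _))
  assoc {a b c d} f g h := by
    obtain ⟨x, hx⟩ := hX.exists_side ![f.1, g.1, h.1] (by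
      intro i
      fin_cases i
      exacts [f.2.2.trans g.2.1.symm, g.2.2.trans h.2.1.symm])
    have hf : side 0 1 x = f.1 := hx 0
    have hg : side 1 2 x = g.1 := hx 1
    have hh : side 2 3 x = h.1 := hx 2
    exact Subtype.ext ((hX.comp_eq x (hX.comp_eq x hf hg).symm hh).trans
      (hX.comp_eq x hf (hX.comp_eq x hg hh).symm).symm)

theorem eqToHom_comp_comp_eqToHom_val {a a' b b' : hX.Obj} (f : a' ⟶ b') (ha : a = a')
    (hb : b' = b) : (eqToHom ha ≫ f ≫ eqToHom hb).1 = f.1 := by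
  subst ha hb
  simp

theorem functor_ext_val {n : ℕ} {x y : Codiscrete (Fin (n + 1)) ⥤ hX.Obj}
    (hobj : ∀ i, x.obj i = y.obj i)
    (hmap : ∀ i : Fin n, (x.map (iso ⟨i.castSucc⟩ ⟨i.succ⟩).hom).1 =
      (y.map (iso ⟨i.castSucc⟩ ⟨i.succ⟩).hom).1) : x = y :=
  functor_ext_succ hobj fun i =>
    Subtype.ext ((hmap i).trans (hX.eqToHom_comp_comp_eqToHom_val _ _ _).symm)

/-- An `n`-simplex as a functor from the chaotic groupoid on `[n]`. -/
def toFunctor {n : ℕ} (x : X.obj (op ⟨n⟩)) : Codiscrete (Fin (n + 1)) ⥤ hX.Obj where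
  obj i := vert i.as x
  map {i j} _ := ⟨side i.as j.as x, vert_zero_side _ _ _, vert_one_side _ _ _⟩
  map_id _ := Subtype.ext (side_self _ _)
  map_comp _ _ := Subtype.ext (hX.comp_eq x rfl rfl).symm

theorem toFunctor_res {m n : ℕ} (g : Fin (m + 1) → Fin (n + 1)) (x : X.obj (op ⟨n⟩)) :
    hX.toFunctor (res g x) = Codiscrete.functorOfFun g ⋙ hX.toFunctor x :=
  hX.functor_ext_val (fun _ => vert_res _ _ _) fun _ => side_res _ _ _ _

theorem toFunctor_bijective (n : ℕ) :
    Function.Bijective (hX.toFunctor : X.obj (op ⟨n⟩) → (Codiscrete (Fin (n + 1)) ⥤ hX.Obj)) := by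
  constructor
  · intro x y h
    cases n with
    | zero =>
      exact (vert_eq_self x 0).symm.trans
        ((CategoryTheory.Functor.congr_obj h ⟨0⟩).trans (vert_eq_self y 0))
    | succ n =>
      refine hX.ext_side fun i => ?_
      have := congrArg Subtype.val
        (CategoryTheory.Functor.congr_hom h (iso ⟨i.castSucc⟩ ⟨i.succ⟩).hom)
      exact this.trans (hX.eqToHom_comp_comp_eqToHom_val _ _ _)
  · intro F
    cases n with
    | zero =>
      refine ⟨F.obj ⟨0⟩, hX.functor_ext_val (fun i => ?_) fun i => i.elim0⟩
      obtain rfl : i = ⟨0⟩ := Codiscrete.ext (Fin.fin_one_eq_zero _)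
      exact vert_eq_self (X := X) _ 0
    | succ n =>
      obtain ⟨x, hx⟩ := hX.exists_side (fun i => (F.map (iso ⟨i.castSucc⟩ ⟨i.succ⟩).hom).1)
        fun i => (F.map _).2.2.trans (F.map (iso ⟨i.succ.castSucc⟩ ⟨i.succ.succ⟩).hom).2.1.symm
      refine ⟨x, hX.functor_ext_val ?_ hx⟩
      rintro ⟨k⟩
      induction k using Fin.cases with
      | zero =>
        refine (vert_zero_side (Fin.castSucc 0) (Fin.succ 0) x).symm.trans ?_
        rw [hx 0]
        exact (F.map (iso ⟨Fin.castSucc 0⟩ ⟨Fin.succ 0⟩).hom).2.1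
      | succ k =>
        refine (vert_one_side k.castSucc k.succ x).symm.trans ?_
        rw [hx k]
        exact (F.map (iso ⟨k.castSucc⟩ ⟨k.succ⟩).hom).2.2

/-- A symmetric simplicial set satisfying the Segal condition is the symmetric nerve of the
groupoid of its vertices and edges. -/
noncomputable def isoSymNerve : X ≅ symNerve.{u}.obj (Grpd.of hX.Obj) :=
  NatIso.ofComponents
    (fun n => (Equiv.ofBijective _ (hX.toFunctor_bijective n.unop.len)).toIso)
    (fun {m n} f => by
      ext x
      exact hX.toFunctor_res f.unop x)

end Segal

theorem of_iso {X Y : SymSimplexᵒᵖ ⥤ Type u} (φ : X ≅ Y) (hX : SymSegal X) :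
    SymSegal Y := by
  have nat : ∀ {m n : ℕ} (g : Fin (m + 1) → Fin (n + 1)) (y : Y.obj (op ⟨n⟩)),
      φ.inv.app _ (Y.map (ofFun g).op y) = X.map (ofFun g).op (φ.inv.app _ y) := fun g y =>
    ConcreteCategory.congr_hom (φ.inv.naturality (ofFun g).op) y
  have nat' : ∀ {m n : ℕ} (g : Fin (m + 1) → Fin (n + 1)) (x : X.obj (op ⟨n⟩)),
      φ.hom.app _ (X.map (ofFun g).op x) = Y.map (ofFun g).op (φ.hom.app _ x) := fun g x =>
    ConcreteCategory.congr_hom (φ.hom.naturality (ofFun g).op) x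
  have hinv : ∀ n (y : Y.obj n), φ.hom.app n (φ.inv.app n y) = y := fun n y =>
    ConcreteCategory.congr_hom (φ.inv_hom_id_app n) y
  have inv_inj : ∀ n, Function.Injective (φ.inv.app n) := fun n =>
    Function.LeftInverse.injective (g := φ.hom.app n) (hinv n)
  intro n hn e he
  obtain ⟨x, hx, hx'⟩ := hX n hn (fun i => φ.inv.app _ (e i)) fun i j hij => by
    rw [← nat, ← nat, he i j hij]
  refine ⟨φ.hom.app _ x, fun i => ?_, fun y hy => ?_⟩
  · rw [← nat', hx, hinv]
  · rw [← hx' (φ.inv.app _ y) fun i => by rw [← nat, hy], hinv]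

end SymSegal

theorem SymSimplex.symNerve_essImage_iff (X : SymSimplexᵒᵖ ⥤ Type u) :
    symNerve.{u}.essImage X ↔ SymSegal X := by
  constructor
  · rintro ⟨C, ⟨φ⟩⟩
    exact SymSegal.of_iso φ (symSegal_symNerveObj C)
  · intro hX
    exact ⟨_, ⟨hX.isoSymNerve.symm⟩⟩

namespace InvGraph

/-! ### Finite trees form a dense generator -/

@[ext]
theorem ofSimpleGraph_edge_ext {V : Type u} {G : SimpleGraph V} {e e' : (ofSimpleGraph G).E}
    (hs : (ofSimpleGraph G).s e = (ofSimpleGraph G).s e')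
    (ht : (ofSimpleGraph G).t e = (ofSimpleGraph G).t e') : e = e' :=
  Subtype.ext (Prod.ext hs ht)

/-- The morphism of involutive graphs induced by a homomorphism of combinatorial graphs. -/
def ofHom {V W : Type u} {G : SimpleGraph V} {H : SimpleGraph W} (φ : G →g H) :
    ofSimpleGraph G ⟶ ofSimpleGraph H where
  onV := φ
  onE e := ⟨(φ e.1.1, φ e.1.2), φ.map_rel e.2⟩
  s_comm _ := rfl
  t_comm _ := rfl
  inv_comm _ := rfl

/-- The isomorphism of involutive graphs induced by an isomorphism of combinatorial graphs. -/
def ofIso {V W : Type u} {G : SimpleGraph V} {H : SimpleGraph W} (φ : G ≃g H) :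
    ofSimpleGraph G ≅ ofSimpleGraph H where
  hom := ofHom φ.toHom
  inv := ofHom φ.symm.toHom
  hom_inv_id := hom_ext φ.symm_apply_apply fun _ =>
    ofSimpleGraph_edge_ext (φ.symm_apply_apply _) (φ.symm_apply_apply _)
  inv_hom_id := hom_ext φ.apply_symm_apply fun _ =>
    ofSimpleGraph_edge_ext (φ.apply_symm_apply _) (φ.apply_symm_apply _)

theorem isAcyc_ofSimpleGraph {V : Type u} [Finite V] {G : SimpleGraph V} (hG : G.IsTree) :
    isAcyc (ofSimpleGraph G) :=
  ⟨V, G, inferInstance, hG, ⟨Iso.refl _⟩⟩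

theorem essentiallySmall_isAcyc : EssentiallySmall.{u} isAcyc.{u}.FullSubcategory := by
  have : Small.{u} (Skeleton isAcyc.{u}.FullSubcategory) := by
    let ι := { p : Σ n : ℕ, SimpleGraph (ULift.{u} (Fin n)) // p.2.IsTree }
    let f : ι → Skeleton isAcyc.{u}.FullSubcategory := fun p =>
      toSkeleton ⟨ofSimpleGraph p.1.2, isAcyc_ofSimpleGraph p.2⟩
    refine small_of_surjective (f := f) fun X => ?_
    obtain ⟨X, rfl⟩ := Quotient.exists_rep X
    obtain ⟨V, G, _, hG, ⟨φ⟩⟩ := X.property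
    obtain ⟨n, ⟨e⟩⟩ := Finite.exists_equiv_fin V
    let ψ := SimpleGraph.Iso.map (e.trans Equiv.ulift.symm) G
    refine ⟨⟨⟨n, _⟩, ψ.isTree_iff.1 hG⟩, Quotient.sound ⟨?_⟩⟩
    exact ObjectProperty.isoMk _ (φ ≪≫ ofIso ψ).symm
  exact (essentiallySmall_iff _).2 ⟨this, inferInstance⟩

/-- The tree with one vertex. -/
def point : isAcyc.{u}.FullSubcategory where
  obj := ofSimpleGraph (⊥ : SimpleGraph PUnit.{u + 1})
  property := isAcyc_ofSimpleGraph SimpleGraph.IsTree.of_subsingleton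

/-- The tree with one edge. -/
def segment : isAcyc.{u}.FullSubcategory where
  obj := ofSimpleGraph (⊤ : SimpleGraph (ULift.{u} Bool))
  property := isAcyc_ofSimpleGraph
    ⟨SimpleGraph.connected_top, SimpleGraph.IsAcyclic.of_card_le_two (by simp)⟩

/-- The edge of `segment` from `false` to `true`. -/
def segment.edge : segment.{u}.obj.E :=
  ⟨(⟨false⟩, ⟨true⟩), by simp [SimpleGraph.top_adj]⟩

theorem segment.edge_cases (e : segment.{u}.obj.E) :
    e = segment.edge ∨ e = segment.obj.inv segment.edge := by
  obtain ⟨⟨⟨a⟩, ⟨b⟩⟩, h⟩ := e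
  have h : a ≠ b := fun hab => h.ne (congrArg _ hab)
  cases a <;> cases b <;> first | exact absurd rfl h | exact Or.inl rfl | exact Or.inr rfl

variable {X Y : InvGraph.{u}}

/-- The morphism from the point classifying a vertex. -/
def fromPoint (x : X.V) : point.obj ⟶ X where
  onV _ := x
  onE e := e.2.elim
  s_comm e := e.2.elim
  t_comm e := e.2.elim
  inv_comm e := e.2.elim

theorem fromPoint_comp (x : X.V) (h : X ⟶ Y) : fromPoint x ≫ h = fromPoint (h.onV x) :=
  hom_ext (fun _ => rfl) fun e => e.2.elim

/-- The morphism from the segment classifying an edge. -/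
def fromSegment (e : X.E) : segment.obj ⟶ X where
  onV b := if b.down then X.t e else X.s e
  onE p := if p.1.1.down then X.inv e else e
  s_comm p := by
    rcases segment.edge_cases p with rfl | rfl
    · rfl
    · exact X.s_inv e
  t_comm p := by
    rcases segment.edge_cases p with rfl | rfl
    · rfl
    · exact X.t_inv e
  inv_comm p := by
    rcases segment.edge_cases p with rfl | rfl
    · rfl
    · exact (X.inv_inv e).symm

theorem hom_segment_ext {g h : segment.obj ⟶ X} (hgh : g.onE segment.edge = h.onE segment.edge) :
    g = h := by
  refine hom_ext ?_ fun p => ?_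
  · rintro ⟨_ | _⟩
    · exact (g.s_comm segment.edge).symm.trans ((congrArg X.s hgh).trans (h.s_comm segment.edge))
    · exact (g.t_comm segment.edge).symm.trans ((congrArg X.t hgh).trans (h.t_comm segment.edge))
  · rcases segment.edge_cases p with rfl | rfl
    · exact hgh
    · rw [g.inv_comm, h.inv_comm, hgh]

theorem fromSegment_comp (e : X.E) (h : X ⟶ Y) : fromSegment e ≫ h = fromSegment (h.onE e) :=
  hom_segment_ext rfl

theorem arityNerve_isAcyc_full : (arityNerve isAcyc.{u}).Full where
  map_surjective {X Y} τ := by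
    -- Vertices and edges of a graph are morphisms from the point and the segment, so a natural map
    -- of nerves is determined by its components there.
    let T : ∀ A : isAcyc.{u}.FullSubcategory, (A.obj ⟶ X) → (A.obj ⟶ Y) :=
      fun A h => τ.app (op A) h
    have hT : ∀ {A B : isAcyc.{u}.FullSubcategory} (k : A.obj ⟶ B.obj) (h : B.obj ⟶ X),
        T A (k ≫ h) = k ≫ T B h := fun k h =>
      ConcreteCategory.congr_hom (τ.naturality (ObjectProperty.homMk k).op) h
    let fV : X.V → Y.V := fun x => (T point (fromPoint x)).onV PUnit.unit
    let fE : X.E → Y.E := fun e => (T segment (fromSegment e)).onE segment.edge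
    have hV : ∀ (A : isAcyc.{u}.FullSubcategory) (h : A.obj ⟶ X) (a : A.obj.V),
        (T A h).onV a = fV (h.onV a) := fun A h a => by
      have := hT (A := point) (fromPoint a) h
      rw [fromPoint_comp, fromPoint_comp] at this
      exact congrArg (fun k => Hom.onV k PUnit.unit) this.symm
    have hE : ∀ (A : isAcyc.{u}.FullSubcategory) (h : A.obj ⟶ X) (a : A.obj.E),
        (T A h).onE a = fE (h.onE a) := fun A h a => by
      have := hT (A := segment) (fromSegment a) h
      rw [fromSegment_comp, fromSegment_comp] at this
      exact congrArg (fun k => Hom.onE k segment.edge) this.symm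
    refine ⟨⟨fV, fE, fun e => ?_, fun e => ?_, fun e => ?_⟩, ?_⟩
    · exact ((T segment (fromSegment e)).s_comm segment.edge).trans (hV _ _ _)
    · exact ((T segment (fromSegment e)).t_comm segment.edge).trans (hV _ _ _)
    · exact (hE segment (fromSegment e) (segment.obj.inv segment.edge)).symm.trans
        ((T segment (fromSegment e)).inv_comm segment.edge)
    · ext A h
      exact hom_ext (fun a => (hV A.unop h a).symm) fun a => (hE A.unop h a).symm

theorem arityNerve_isAcyc_faithful : (arityNerve isAcyc.{u}).Faithful where
  map_injective {X Y} f g hfg := by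
    have key : ∀ (A : isAcyc.{u}.FullSubcategory) (h : A.obj ⟶ X), h ≫ f = h ≫ g := fun A h =>
      ConcreteCategory.congr_hom (NatTrans.congr_app hfg (op A)) h
    exact hom_ext
      (fun x => congrArg (fun k => Hom.onV k PUnit.unit) (key point (fromPoint x)))
      fun e => congrArg (fun k => Hom.onE k segment.edge) (key segment (fromSegment e))

theorem isDenseGenerator_isAcyc : IsDenseGenerator isAcyc.{u} where
  essentiallySmall := essentiallySmall_isAcyc
  full := arityNerve_isAcyc_full
  faithful := arityNerve_isAcyc_faithful

end InvGraph

/-! ### Acyclicity from a depth function -/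

/-- A graph is acyclic as soon as its vertices have depths such that adjacent vertices have distinct
depths and each vertex has at most one neighbour of smaller depth. -/
theorem SimpleGraph.isAcyclic_of_depth {V : Type u} {G : SimpleGraph V} (d : V → ℕ)
    (hne : ∀ a b, G.Adj a b → d a ≠ d b)
    (huniq : ∀ a b b', G.Adj a b → G.Adj a b' → d b < d a → d b' < d a → b = b') :
    G.IsAcyclic := by
  classical
  intro v c hc
  -- Both neighbours in the cycle of a vertex of maximal depth would be its neighbour of smaller
  -- depth.
  obtain ⟨a, ha, hmax⟩ := c.support.toFinset.exists_max_image d ⟨v, by simp⟩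
  rw [List.mem_toFinset] at ha
  have hc' := hc.rotate ha
  have hlt : ∀ b ∈ (c.rotate a ha).support, G.Adj a b → d b < d a := fun b hb hab =>
    lt_of_le_of_ne (hmax b (by
      rw [List.mem_toFinset]
      exact (c.mem_support_rotate_iff a ha).1 hb)) (hne a b hab).symm
  have hs := (c.rotate a ha).adj_snd hc'.not_nil
  have hp := ((c.rotate a ha).adj_penultimate hc'.not_nil).symm
  exact hc'.snd_ne_penultimate (huniq a _ _ hs hp
    (hlt _ (SimpleGraph.Walk.getVert_mem_support _ _) hs)
    (hlt _ (SimpleGraph.Walk.getVert_mem_support _ _) hp))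

namespace InvGraph

variable {X Y : InvGraph.{u}}

/-! ### Reduced words -/

/-- To prove a property of the morphisms of the free groupoid with a fixed source, it suffices to
prove it for the identity and to prove that it is preserved under composition with edges. -/
theorem FreeGpd.induction {x : FreeGpd X} (P : ∀ {b : X.Vert}, (x ⟶ vtx b) → Prop)
    (id : P (b := x.as) (𝟙 x))
    (comp : ∀ {b c : X.Vert} (γ : x ⟶ vtx b) (e : b ⟶ c), P γ → P (γ ≫ cls e))
    {b : X.Vert} (γ : x ⟶ vtx b) : P γ := by
  obtain ⟨p, rfl⟩ := (CategoryTheory.Quotient.functor (redundancy X)).map_surjective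
    (X := x.as) (Y := b) γ
  refine Paths.induction_fixed_source (a := x.as)
    (fun {b} p => P (b := b) ((CategoryTheory.Quotient.functor (redundancy X)).map p)) ?_ ?_ p
  · exact id
  · intro a b p q h
    exact comp _ q h

variable (X) in
/-- The reduced words in the edges of an involutive graph, with the most recent letter first.
No compatibility between sources and targets is required. -/
@[ext]
structure RedWord : Type u where
  /-- The letters of the word. -/
  letters : List X.E
  reduced : letters.IsChain fun e e' => e' ≠ X.inv e

open Classical in
/-- Multiplication of a reduced word by an edge: the last letter is cancelled if it is dual to that
edge, and otherwise the edge is appended. -/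
noncomputable def RedWord.act (e : X.E) (w : RedWord X) : RedWord X :=
  if h : w.letters.head? = some (X.inv e) then ⟨w.letters.tail, w.reduced.tail⟩
  else ⟨e :: w.letters,
    List.isChain_cons.2 ⟨fun e' he' he => h (by rw [← he]; exact he'), w.reduced⟩⟩

theorem RedWord.act_cases (e : X.E) (w : RedWord X) :
    (w.letters = X.inv e :: (w.act e).letters) ∨
      ((w.act e).letters = e :: w.letters ∧ w.letters.head? ≠ some (X.inv e)) := by
  by_cases h : w.letters.head? = some (X.inv e)
  · rw [act, dif_pos h]
    exact Or.inl (List.cons_head?_tail h).symm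
  · rw [act, dif_neg h]
    exact Or.inr ⟨rfl, h⟩

theorem RedWord.act_inv_act (e : X.E) (w : RedWord X) : (w.act e).act (X.inv e) = w := by
  rcases (w.act e).act_cases (X.inv e) with h | ⟨h, h'⟩ <;> rcases w.act_cases e with k | ⟨k, k'⟩
  · rw [X.inv_inv] at h
    have := w.reduced
    rw [k, h] at this
    exact absurd (X.inv_inv e).symm (List.isChain_cons_cons.1 this).1
  · rw [k] at h
    exact RedWord.ext (List.cons.inj h).2.symm
  · exact RedWord.ext (h.trans k.symm)
  · rw [k, X.inv_inv] at h'
    exact absurd rfl h'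

theorem RedWord.length_act_ne (e : X.E) (w : RedWord X) :
    (w.act e).letters.length ≠ w.letters.length := by
  rcases w.act_cases e with k | ⟨k, -⟩
  · rw [k]; simp
  · rw [k]; simp

theorem RedWord.act_injective (w : RedWord X) : Function.Injective fun e => w.act e := by
  intro e e' (h : w.act e = w.act e')
  rcases w.act_cases e with k | ⟨k, -⟩ <;> rcases w.act_cases e' with k' | ⟨k', -⟩
  · rw [k, h] at k'
    rw [← X.inv_inv e, (List.cons.inj k').1, X.inv_inv]
  · have := congrArg List.length k
    rw [h, k'] at this
    simp only [List.length_cons] at this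
    omega
  · have := congrArg List.length k'
    rw [← h, k] at this
    simp only [List.length_cons] at this
    omega
  · rw [h, k'] at k
    exact (List.cons.inj k).1.symm

theorem RedWord.eq_of_length_act_lt {e e' : X.E} {w : RedWord X}
    (h : (w.act e).letters.length < w.letters.length)
    (h' : (w.act e').letters.length < w.letters.length) :
    e = e' := by
  rcases w.act_cases e with k | ⟨k, -⟩ <;> rcases w.act_cases e' with k' | ⟨k', -⟩
  · rw [k] at k'
    rw [← X.inv_inv e, (List.cons.inj k').1, X.inv_inv]
  · simp [k'] at h'
  · simp [k] at h
  · simp [k] at h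

variable (X) in
/-- The action of the free groupoid on reduced words. -/
noncomputable def wordAction : FreeGpd X ⥤ Type u :=
  CategoryTheory.Quotient.lift (redundancy X)
    (Paths.lift { obj := fun _ => RedWord X, map := fun f => ↾fun w => RedWord.act f.1 w })
    (by
      rintro _ _ _ _ ⟨a, b, f⟩
      refine (Functor.map_comp _ _ _).trans ?_
      refine (congrArg₂ _ (Paths.lift_toPath _ f) (Paths.lift_toPath _ (dual f))).trans ?_
      refine Eq.trans ?_ (CategoryTheory.Functor.map_id _ _).symm
      ext w
      exact RedWord.act_inv_act f.1 w)

/-- The reduced word of a morphism of the free groupoid, computed by letting it act on the empty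
word. -/
noncomputable def word {x y : FreeGpd X} (γ : x ⟶ y) : RedWord X :=
  (wordAction X).map γ (show RedWord X from ⟨[], List.isChain_nil⟩)

theorem word_comp_cls {x : FreeGpd X} {a b : X.Vert} (γ : x ⟶ vtx a) (e : a ⟶ b) :
    word (γ ≫ cls e) = (word γ).act e.1 := by
  unfold word
  rw [Functor.map_comp]
  exact ConcreteCategory.congr_hom (Paths.lift_toPath _ e : (wordAction X).map (cls e) = _) _

/-! ### The universal cover -/

/-- The vertices of the universal cover of an involutive graph: morphisms of the free groupoid
with a fixed source. -/
structure Cover (x : FreeGpd X) : Type u where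
  /-- The vertex lying below. -/
  pt : X.Vert
  /-- The morphism from the base vertex. -/
  path : x ⟶ vtx pt

/-- The base vertex of the universal cover. -/
def Cover.base (x : FreeGpd X) : Cover x := ⟨x.as, 𝟙 x⟩

theorem comp_cls_dual {x : FreeGpd X} {a b : X.Vert} {γ : x ⟶ vtx a} {δ : x ⟶ vtx b} {e : a ⟶ b}
    (h : γ ≫ cls e = δ) : δ ≫ cls (dual e) = γ := by
  rw [← h, Category.assoc, cls_dual, Category.comp_id]

/-- The universal cover of an involutive graph, as a combinatorial graph. -/
def coverGraph (x : FreeGpd X) : SimpleGraph (Cover x) where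
  Adj p q := ∃ e : p.pt ⟶ q.pt, p.path ≫ cls e = q.path
  symm := ⟨by
    rintro p q ⟨e, he⟩
    exact ⟨dual e, comp_cls_dual he⟩⟩
  loopless := ⟨by
    rintro p ⟨e, he⟩
    refine (word p.path).length_act_ne e.1 ?_
    rw [← word_comp_cls, he]⟩

/-- The edges of an involutive graph embed into its free groupoid, so that an edge of the universal
cover lies over a unique edge. -/
theorem coverGraph_edge_unique {x : FreeGpd X} {p q : Cover x} {e e' : p.pt ⟶ q.pt}
    (he : p.path ≫ cls e = q.path) (he' : p.path ≫ cls e' = q.path) : e = e' := by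
  refine Subtype.ext ((word p.path).act_injective ?_)
  change (word p.path).act e.1 = (word p.path).act e'.1
  rw [← word_comp_cls, ← word_comp_cls, he, he']

/-- The depth of a vertex is the length of its reduced word: a neighbour of smaller depth is
obtained by cancelling the last letter. -/
theorem coverGraph_isAcyclic (x : FreeGpd X) : (coverGraph x).IsAcyclic := by
  refine SimpleGraph.isAcyclic_of_depth (fun p => (word p.path).letters.length) ?_ ?_
  · rintro p q ⟨e, he⟩
    rw [← he, word_comp_cls]
    exact ((word p.path).length_act_ne e.1).symm
  · rintro p ⟨y, γ⟩ ⟨y', γ'⟩ ⟨e, he⟩ ⟨e', he'⟩ h h'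
    dsimp only at e e' he he' h h'
    subst he he'
    rw [word_comp_cls] at h h'
    have hee := RedWord.eq_of_length_act_lt h h'
    obtain ⟨e, hs, rfl⟩ := e
    obtain ⟨e', hs', rfl⟩ := e'
    obtain rfl : e = e' := hee
    rfl

theorem coverGraph_preconnected (x : FreeGpd X) : (coverGraph x).Preconnected := by
  have h : ∀ p : Cover x, (coverGraph x).Reachable (Cover.base x) p := by
    rintro ⟨y, γ⟩
    induction γ using FreeGpd.induction with
    | id => rfl
    | comp γ e ih => exact ih.trans (SimpleGraph.Adj.reachable ⟨e, rfl⟩)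
  exact fun p q => (h p).symm.trans (h q)

/-! ### The free groupoid on a tree is chaotic -/

section Tree

variable {V : Type u} {G : SimpleGraph V}

/-- The edge of an involutive graph given by a pair of adjacent vertices. -/
def adjEdge {a b : V} (h : G.Adj a b) :
    @Quiver.Hom (ofSimpleGraph G).Vert _ a b :=
  ⟨⟨(a, b), h⟩, rfl, rfl⟩

/-- The class of a walk in the free groupoid. -/
def walkCls {a b : V} (p : G.Walk a b) :
    vtx (show (ofSimpleGraph G).Vert from a) ⟶ vtx (show (ofSimpleGraph G).Vert from b) :=
  match p with
  | .nil => 𝟙 _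
  | .cons h p => cls (adjEdge h) ≫ walkCls p

theorem walkCls_concat {a b c : V} (p : G.Walk a b) (h : G.Adj b c) :
    walkCls (p.concat h) = walkCls p ≫ cls (adjEdge h) := by
  induction p with
  | nil => exact (Category.comp_id _).trans (Category.id_comp _).symm
  | cons h' p ih =>
    change cls (adjEdge h') ≫ walkCls (p.concat h) = (cls (adjEdge h') ≫ walkCls p) ≫ _
    rw [ih, Category.assoc]

theorem walkCls_comp_cls (hG : G.IsAcyclic) {r a b : V} {p : G.Walk r a} {q : G.Walk r b}
    (hp : p.IsPath) (hq : q.IsPath) (h : G.Adj a b) :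
    walkCls p ≫ cls (adjEdge h) = walkCls q := by
  by_cases ha : a ∈ q.support
  · rw [hG.path_concat hp hq h ha, walkCls_concat]
  · have hb : b ∈ p.support := hG.mem_support_of_ne_mem_support_of_adj_of_isPath hp hq h ha
    rw [hG.path_concat hq hp h.symm hb, walkCls_concat, Category.assoc]
    exact (congrArg _ (dual_cls (adjEdge h))).trans (Category.comp_id _)

/-- Between any two vertices of a tree there is a unique morphism of the free groupoid: by induction,
a morphism carries the class of the path from the base vertex to its source to the class of
the path to its target. -/
theorem chaotic_freeGpd_ofSimpleGraph (hG : G.IsTree) (x y : FreeGpd (ofSimpleGraph G)) :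
    Nonempty (Unique (x ⟶ y)) := by
  choose p hp using fun v => (hG.existsUnique_path x.as v).exists
  have key : ∀ {b : (ofSimpleGraph G).Vert} (γ : x ⟶ vtx b),
      walkCls (p x.as) ≫ γ = walkCls (p b) := by
    intro b γ
    induction γ using FreeGpd.induction with
    | id => exact Category.comp_id _
    | comp γ e ih =>
      obtain ⟨⟨⟨b, c⟩, h⟩, rfl, rfl⟩ := e
      refine (Category.assoc _ _ _).symm.trans ((congrArg (· ≫ _) ih).trans ?_)
      exact walkCls_comp_cls hG.isAcyclic (hp _) (hp _) h
  refine ⟨⟨⟨walkCls (p y.as)⟩, fun γ => ?_⟩⟩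
  exact (cancel_epi (walkCls (p x.as))).1 ((key (b := y.as) γ).trans (key (b := y.as) _).symm)

end Tree

end InvGraph

/-! ### A criterion for colimits of types -/

/-- A cocone of types is a colimit cocone if it is jointly surjective and any two elements with the
same image in the vertex become equal at a common target. -/
theorem CategoryTheory.Limits.Types.nonempty_isColimit_of_cospans {J : Type w} [Category.{v} J]
    {F : J ⥤ Type u} (c : Limits.Cocone F)
    (hsurj : ∀ y : c.pt, ∃ (j : J) (x : F.obj j), c.ι.app j x = y)
    (hinj : ∀ (i j : J) (x : F.obj i) (y : F.obj j), c.ι.app i x = c.ι.app j y →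
      ∃ (k : J) (f : i ⟶ k) (g : j ⟶ k), F.map f x = F.map g y) :
    Nonempty (Limits.IsColimit c) := by
  choose j x hx using hsurj
  have key : ∀ (s : Limits.Cocone F) (i : J) (z : F.obj i),
      s.ι.app _ (x (c.ι.app i z)) = s.ι.app i z := by
    intro s i z
    obtain ⟨k, f, g, h⟩ := hinj _ _ _ _ (hx (c.ι.app i z))
    have hf := ConcreteCategory.congr_hom (s.w f) (x (c.ι.app i z))
    have hg := ConcreteCategory.congr_hom (s.w g) z
    rw [← hf, ← hg]
    exact congrArg (s.ι.app k) h
  refine ⟨{ desc := fun s => ↾fun y => s.ι.app _ (x y), fac := ?_, uniq := ?_ }⟩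
  · intro s i
    ext z
    exact key s i z
  · intro s m hm
    ext y
    refine (congrArg m (hx y).symm).trans ?_
    exact ConcreteCategory.congr_hom (hm (j y)) (x y)

namespace InvGraph

variable {X Y Z : InvGraph.{u}}

/-! ### The free groupoid functor on finite trees -/

/-- The functor between free groupoids induced by a morphism of involutive graphs. -/
noncomputable def mapFree (f : X ⟶ Y) : FreeGpd X ⥤ FreeGpd Y := (freeGrpd.map f : _ ⟶ _)

theorem mapFree_id (X : InvGraph.{u}) : mapFree (𝟙 X) = 𝟭 _ := freeGrpd.map_id X

theorem mapFree_comp (f : X ⟶ Y) (g : Y ⟶ Z) : mapFree (f ≫ g) = mapFree f ⋙ mapFree g :=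
  freeGrpd.map_comp f g

/-- The image of an edge under a morphism of involutive graphs. -/
def mapEdge (f : X ⟶ Y) {a b : X.Vert} (e : a ⟶ b) :
    @Quiver.Hom Y.Vert _ (f.onV a) (f.onV b) :=
  ⟨f.onE e.1, (f.s_comm _).trans (congrArg f.onV e.2.1), (f.t_comm _).trans (congrArg f.onV e.2.2)⟩

theorem mapFree_map_cls (f : X ⟶ Y) {a b : X.Vert} (e : a ⟶ b) :
    (mapFree f).map (cls e) = cls (mapEdge f e) := by
  refine (liftFree_cls (f ≫ restrictFree (𝟭 (FreeGpd Y))) e).trans ?_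
  refine valueAt_unique _ _ _ ?_
  exact (map_cls_edge (𝟭 (FreeGpd Y)) (mapEdge f e)).symm

theorem chaotic_freeGpd_of_isAcyc (hX : isAcyc X) (x y : FreeGpd X) :
    Nonempty (Unique (x ⟶ y)) := by
  obtain ⟨V, G, -, hG, ⟨φ⟩⟩ := hX
  have h : mapFree φ.hom ⋙ mapFree φ.inv = 𝟭 _ := by
    rw [← mapFree_comp, φ.hom_inv_id, mapFree_id]
  obtain ⟨i⟩ := chaotic_freeGpd_ofSimpleGraph hG ((mapFree φ.hom).obj x) ((mapFree φ.hom).obj y)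
  refine ⟨⟨⟨eqToHom (Functor.congr_obj h x).symm ≫ (mapFree φ.inv).map i.default ≫
    eqToHom (Functor.congr_obj h y)⟩, fun γ => ?_⟩⟩
  have hγ := Functor.congr_hom h γ
  rw [Functor.comp_map, i.uniq ((mapFree φ.hom).map γ)] at hγ
  change γ = eqToHom _ ≫ (mapFree φ.inv).map i.default ≫ eqToHom _
  rw [hγ]
  simp

theorem finite_of_isAcyc (hX : isAcyc X) : Finite X.V := by
  obtain ⟨V, G, _, -, ⟨φ⟩⟩ := hX
  refine Finite.of_injective (β := V) φ.hom.onV ?_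
  exact Function.LeftInverse.injective (g := φ.inv.onV)
    fun x => congrArg (fun k => Hom.onV k x) φ.hom_inv_id

theorem nonempty_of_isAcyc (hX : isAcyc X) : Nonempty X.V := by
  obtain ⟨V, G, -, hG, ⟨φ⟩⟩ := hX
  exact hG.connected.nonempty.map φ.inv.onV

/-- The unique morphism between two vertices of a tree. -/
noncomputable def treeHom (hX : isAcyc X) (x y : FreeGpd X) : x ⟶ y :=
  (chaotic_freeGpd_of_isAcyc hX x y).some.default

theorem treeHom_unique (hX : isAcyc X) {x y : FreeGpd X} (γ γ' : x ⟶ y) : γ = γ' :=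
  (chaotic_freeGpd_of_isAcyc hX x y).some.instSubsingleton.elim γ γ'

/-- A functor to the free groupoid on a tree is given by its values on objects. -/
noncomputable def functorToTree {C : Type u} [Category.{u} C] (hX : isAcyc X)
    (f : C → FreeGpd X) : C ⥤ FreeGpd X where
  obj := f
  map _ := treeHom hX _ _
  map_id _ := treeHom_unique hX _ _
  map_comp _ _ := treeHom_unique hX _ _

theorem functorToTree_ext {C : Type u} [Category.{u} C] (hX : isAcyc X) {F F' : C ⥤ FreeGpd X}
    (h : ∀ c, F.obj c = F'.obj c) : F = F' :=
  CategoryTheory.Functor.ext h fun _ _ _ => treeHom_unique hX _ _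

section Subtree

variable {x : FreeGpd X} (S : Set (Cover x))

/-- The part of the universal cover spanned by a set of vertices, as an involutive graph. -/
abbrev coverPart : InvGraph.{u} := ofSimpleGraph ((coverGraph x).induce S)

/-- The covering map. -/
noncomputable def proj : coverPart S ⟶ X where
  onV p := p.1.pt
  onE e := (show (coverGraph x).Adj e.1.1.1 e.1.2.1 from e.2).choose.1
  s_comm e := (show (coverGraph x).Adj e.1.1.1 e.1.2.1 from e.2).choose.2.1
  t_comm e := (show (coverGraph x).Adj e.1.1.1 e.1.2.1 from e.2).choose.2.2
  inv_comm e := by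
    have h : (coverGraph x).Adj e.1.1.1 e.1.2.1 := e.2
    exact congrArg Subtype.val
      (coverGraph_edge_unique h.symm.choose_spec (comp_cls_dual h.choose_spec))

theorem proj_onE_eq {p q : Cover x} (hp : p ∈ S) (hq : q ∈ S) (e : p.pt ⟶ q.pt)
    (he : p.path ≫ cls e = q.path) :
    (proj S).onE ⟨(⟨p, hp⟩, ⟨q, hq⟩), ⟨e, he⟩⟩ = e.1 :=
  congrArg Subtype.val (coverGraph_edge_unique
    (show (coverGraph x).Adj p q from ⟨e, he⟩).choose_spec he)

/-- The covering map sends the morphisms between two vertices of a subtree to the difference of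
these two vertices, regarded as morphisms of the free groupoid. -/
theorem comp_mapFree_proj (p q : S)
    (γ : vtx (show (coverPart S).Vert from p) ⟶ vtx (show (coverPart S).Vert from q)) :
    p.1.path ≫ (mapFree (proj S)).map γ = q.1.path := by
  have key : ∀ {q : (coverPart S).Vert} (γ : vtx (show (coverPart S).Vert from p) ⟶ vtx q),
      p.1.path ≫ (mapFree (proj S)).map γ = (show S from q).1.path := by
    intro q γ
    induction γ using FreeGpd.induction with
    | id => exact (congrArg _ ((mapFree (proj S)).map_id _)).trans (Category.comp_id _)
    | comp γ e ih =>
      obtain ⟨⟨⟨b, c⟩, h⟩, rfl, rfl⟩ := e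
      refine (congrArg _ (((mapFree (proj S)).map_comp _ _).trans
        (congrArg _ (mapFree_map_cls _ _)))).trans ?_
      refine (Category.assoc _ _ _).symm.trans ((congrArg (· ≫ _) ih).trans ?_)
      exact (show (coverGraph x).Adj b.1 c.1 from h).choose_spec
  exact key γ

end Subtree

section Factorization

variable {A B : InvGraph.{u}} (hA : isAcyc A) (hB : isAcyc B) (r : FreeGpd A)

/-- The position in the universal cover of the value at a vertex of a functor defined on the free
groupoid on a tree. -/
noncomputable def position (Φ : FreeGpd A ⥤ FreeGpd X) (a : FreeGpd A) : Cover (Φ.obj r) :=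
  ⟨(Φ.obj a).as, Φ.map (treeHom hA r a)⟩

/-- The functor to the free groupoid on a subtree of the universal cover through which a functor
defined on the free groupoid on a tree factors. -/
noncomputable def toCoverPart (Φ : FreeGpd A ⥤ FreeGpd X) {S : Set (Cover (Φ.obj r))}
    (hS : isAcyc (coverPart S)) (hr : ∀ a, position hA r Φ a ∈ S) :
    FreeGpd A ⥤ FreeGpd (coverPart S) :=
  functorToTree hS fun a =>
    vtx (show (coverPart S).Vert from (⟨position hA r Φ a, hr a⟩ : S))

theorem toCoverPart_comp_mapFree_proj (Φ : FreeGpd A ⥤ FreeGpd X) {S : Set (Cover (Φ.obj r))}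
    (hS : isAcyc (coverPart S)) (hr : ∀ a, position hA r Φ a ∈ S) :
    toCoverPart hA r Φ hS hr ⋙ mapFree (proj S) = Φ := by
  refine CategoryTheory.Functor.ext (fun _ => rfl) fun a b γ => ?_
  refine Eq.trans ?_ ((Category.id_comp _).trans (Category.comp_id _)).symm
  refine (cancel_epi (Φ.map (treeHom hA r a))).1 ?_
  have h : Φ.map (treeHom hA r a) ≫ Φ.map γ = Φ.map (treeHom hA r b) :=
    (Φ.map_comp _ _).symm.trans (congrArg _ (treeHom_unique hA _ _))
  refine Eq.trans ?_ h.symm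
  exact comp_mapFree_proj S ⟨position hA r Φ a, hr a⟩ ⟨position hA r Φ b, hr b⟩ _

include hB in
/-- The unique lifting property of the universal cover. If a functor `Φ` between free groupoids
factors through a tree `B` over `X`, then `B` maps to every subtree of the universal cover which is
large enough, compatibly with the factorizations of `Φ`. -/
theorem exists_lift (Φ : FreeGpd A ⥤ FreeGpd X) (Ψ : FreeGpd A ⥤ FreeGpd B) (h : B ⟶ X)
    (hΦ : Ψ ⋙ mapFree h = Φ) :
    ∃ T : Finset (Cover (Φ.obj r)), ∀ (S : Set (Cover (Φ.obj r))) (_ : (T : Set _) ⊆ S)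
      (hS : isAcyc (coverPart S)) (hr : ∀ a, position hA r Φ a ∈ S),
      ∃ k : B ⟶ coverPart S, k ≫ proj S = h ∧ Ψ ⋙ mapFree k = toCoverPart hA r Φ hS hr := by
  classical
  subst hΦ
  -- `B` is lifted to the universal cover by transporting its vertices along the morphisms from the
  -- image of `r`; adjacency is preserved as the free groupoid on `B` is chaotic.
  let pos : B.V → Cover ((mapFree h).obj (Ψ.obj r)) := fun b =>
    ⟨h.onV b, (mapFree h).map (treeHom hB (Ψ.obj r) (vtx (show B.Vert from b)))⟩
  have hpos : ∀ e : B.E, (pos (B.s e)).path ≫ cls (mapEdge h (B.edge e)) = (pos (B.t e)).path := by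
    intro e
    refine (congrArg _ (mapFree_map_cls h (B.edge e)).symm).trans ?_
    refine ((mapFree h).map_comp _ _).symm.trans ?_
    exact congrArg _ (treeHom_unique hB _ _)
  have := finite_of_isAcyc hB
  have := Fintype.ofFinite B.V
  refine ⟨Finset.univ.image pos, fun S hT hS hr => ?_⟩
  have hmem : ∀ b, pos b ∈ S := fun b => hT (by simp)
  let k : B ⟶ coverPart S :=
    { onV := fun b => ⟨pos b, hmem b⟩
      onE := fun e => ⟨(⟨pos (B.s e), hmem _⟩, ⟨pos (B.t e), hmem _⟩), ⟨_, hpos e⟩⟩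
      s_comm := fun _ => rfl
      t_comm := fun _ => rfl
      inv_comm := fun e => ofSimpleGraph_edge_ext
        (congrArg (fun b => (⟨pos b, hmem b⟩ : S)) (B.s_inv e))
        (congrArg (fun b => (⟨pos b, hmem b⟩ : S)) (B.t_inv e)) }
  refine ⟨k, hom_ext (fun _ => rfl) fun e =>
    proj_onE_eq (p := pos (B.s e)) (q := pos (B.t e)) S (hmem _) (hmem _) _ (hpos e), ?_⟩
  refine functorToTree_ext hS fun a => ?_
  have : pos (Ψ.obj a).as = position hA r (Ψ ⋙ mapFree h) a :=
    congrArg (fun γ => (⟨_, (mapFree h).map γ⟩ : Cover ((mapFree h).obj (Ψ.obj r))))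
      (treeHom_unique hB _ _)
  exact congrArg (fun p : S => vtx (show (coverPart S).Vert from p)) (Subtype.ext this)

/-- Finite sets of vertices of the universal cover are contained in finite subtrees. -/
theorem exists_isAcyc_coverPart {x : FreeGpd X} (T : Finset (Cover x)) :
    ∃ S : Set (Cover x), (T : Set _) ⊆ S ∧ isAcyc (coverPart S) := by
  classical
  obtain ⟨S, hS, hc⟩ := SimpleGraph.extend_finset_to_connected (coverGraph_preconnected x)
    (t := insert (Cover.base x) T) (by simp)
  exact ⟨S, fun p hp => hS (by simp [Finset.mem_coe.1 hp]),
    isAcyc_ofSimpleGraph ⟨hc, (coverGraph_isAcyclic x).induce _⟩⟩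

end Factorization

/-- Naturality of the adjunction in the groupoid. -/
theorem liftFree_comp_map {C D : Grpd.{u, u}} (φ : X ⟶ forgetGrpd.obj C) (K : C ⟶ D) :
    liftFree (φ ≫ forgetGrpd.map K : X ⟶ ofGroupoid D) =
      liftFree (φ : X ⟶ ofGroupoid C) ⋙ (K : C ⥤ D) := by
  rw [← liftFree_restrictFree (liftFree (φ : X ⟶ ofGroupoid C) ⋙ (K : C ⥤ D))]
  congr 1
  exact congrArg (fun ψ : X ⟶ ofGroupoid C => ψ ≫ forgetGrpd.map K) (restrictFree_liftFree φ).symm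

/-- A morphism to the underlying involutive graph of a free groupoid, as a functor out of the free
groupoid. -/
noncomputable def transpose {A B : InvGraph.{u}} (α : A ⟶ freeGroupoidMonad.obj B) :
    FreeGpd A ⥤ FreeGpd B :=
  liftFree (C := FreeGpd B) α

theorem transpose_comp_map {A B : InvGraph.{u}} (α : A ⟶ freeGroupoidMonad.obj B) (h : B ⟶ X) :
    transpose (α ≫ freeGroupoidMonad.map h) = transpose α ⋙ mapFree h :=
  liftFree_comp_map (C := freeGrpd.obj B) α (freeGrpd.map h)

theorem transpose_injective {A B : InvGraph.{u}} :
    Function.Injective (transpose : (A ⟶ freeGroupoidMonad.obj B) → _) := fun α β h =>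
  (restrictFree_liftFree (C := FreeGpd B) α).symm.trans
    ((congrArg restrictFree h).trans (restrictFree_liftFree (C := FreeGpd B) β))

theorem transpose_surjective {A B : InvGraph.{u}} :
    Function.Surjective (transpose : (A ⟶ freeGroupoidMonad.obj B) → _) := fun F =>
  ⟨restrictFree F, liftFree_restrictFree F⟩

/-! ### Factorizations through finite trees -/

section Factor

variable {A B B' : InvGraph.{u}} (hA : isAcyc A)

include hA in
/-- A morphism from a tree to the underlying graph of a free groupoid factors through a finite
subtree of the universal cover. -/
theorem exists_factor (φ : A ⟶ freeGroupoidMonad.obj X) :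
    ∃ (C : InvGraph.{u}) (_ : isAcyc C) (h : C ⟶ X) (α : A ⟶ freeGroupoidMonad.obj C),
      α ≫ freeGroupoidMonad.map h = φ := by
  classical
  obtain ⟨a⟩ := nonempty_of_isAcyc hA
  have := finite_of_isAcyc hA
  have := Fintype.ofFinite A.V
  let r : FreeGpd A := vtx (show A.Vert from a)
  obtain ⟨S, hT, hS⟩ := exists_isAcyc_coverPart (Finset.univ.image fun a : A.V =>
    position hA r (transpose φ) (vtx (show A.Vert from a)))
  have hr : ∀ a, position hA r (transpose φ) a ∈ S := fun a =>
    hT (Finset.mem_coe.2 (Finset.mem_image.2 ⟨a.as, Finset.mem_univ _, rfl⟩))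
  obtain ⟨α, hα⟩ := transpose_surjective (toCoverPart hA r (transpose φ) hS hr)
  refine ⟨coverPart S, hS, proj S, α, transpose_injective ?_⟩
  rw [transpose_comp_map, hα, toCoverPart_comp_mapFree_proj]

include hA in
/-- Two factorizations of the same morphism become equal in a finite subtree of the universal cover
containing both. -/
theorem exists_common_factor (hB : isAcyc B) (hB' : isAcyc B') {h : B ⟶ X} {h' : B' ⟶ X}
    {α : A ⟶ freeGroupoidMonad.obj B} {α' : A ⟶ freeGroupoidMonad.obj B'}
    (hα : α ≫ freeGroupoidMonad.map h = α' ≫ freeGroupoidMonad.map h') :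
    ∃ (C : InvGraph.{u}) (_ : isAcyc C) (g : C ⟶ X) (k : B ⟶ C) (k' : B' ⟶ C),
      k ≫ g = h ∧ k' ≫ g = h' ∧
        α ≫ freeGroupoidMonad.map k = α' ≫ freeGroupoidMonad.map k' := by
  classical
  obtain ⟨a⟩ := nonempty_of_isAcyc hA
  have := finite_of_isAcyc hA
  have := Fintype.ofFinite A.V
  let r : FreeGpd A := vtx (show A.Vert from a)
  let Φ := transpose (α ≫ freeGroupoidMonad.map h)
  obtain ⟨T, hT⟩ := exists_lift hA hB r Φ (transpose α) h (transpose_comp_map α h).symm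
  obtain ⟨T', hT'⟩ := exists_lift hA hB' r Φ (transpose α') h'
    ((transpose_comp_map α' h').symm.trans (congrArg _ hα.symm))
  obtain ⟨S, hTS, hS⟩ := exists_isAcyc_coverPart ((Finset.univ.image fun a : A.V =>
    position hA r Φ (vtx (show A.Vert from a))) ∪ (T ∪ T'))
  have hr : ∀ a, position hA r Φ a ∈ S := fun a =>
    hTS (Finset.mem_coe.2 (Finset.mem_union_left _
      (Finset.mem_image.2 ⟨a.as, Finset.mem_univ _, rfl⟩)))
  obtain ⟨k, hk, hαk⟩ := hT S (fun p hp => hTS (Finset.mem_coe.2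
    (Finset.mem_union_right _ (Finset.mem_union_left _ hp)))) hS hr
  obtain ⟨k', hk', hαk'⟩ := hT' S (fun p hp => hTS (Finset.mem_coe.2
    (Finset.mem_union_right _ (Finset.mem_union_right _ hp)))) hS hr
  refine ⟨coverPart S, hS, proj S, k, k', hk, hk', transpose_injective ?_⟩
  rw [transpose_comp_map, transpose_comp_map, hαk, hαk']

end Factor

theorem hasArities_freeGroupoidMonad : HasArities freeGroupoidMonad.{u} isAcyc.{u} where
  isDenseGenerator := isDenseGenerator_isAcyc
  isColimit X := by
    refine ⟨Limits.evaluationJointlyReflectsColimits _ fun A => Nonempty.some ?_⟩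
    refine Limits.Types.nonempty_isColimit_of_cospans _ ?_ ?_
    · intro φ
      obtain ⟨C, hC, h, α, hα⟩ := exists_factor (X := X) A.unop.property φ
      let j : CostructuredArrow isAcyc.ι X :=
        CostructuredArrow.mk (Y := (⟨C, hC⟩ : isAcyc.FullSubcategory)) h
      exact ⟨j, α, hα⟩
    · intro i j α α' hα
      obtain ⟨C, hC, g, k, k', hk, hk', hkk'⟩ := exists_common_factor (X := X) A.unop.property
        (B := i.left.obj) (B' := j.left.obj) i.left.property j.left.property (h := i.hom)
        (h' := j.hom) (α := α) (α' := α') hα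
      let l : CostructuredArrow isAcyc.ι X :=
        CostructuredArrow.mk (Y := (⟨C, hC⟩ : isAcyc.FullSubcategory)) g
      let f : i ⟶ l := CostructuredArrow.homMk (ObjectProperty.homMk k) hk
      let f' : j ⟶ l := CostructuredArrow.homMk (ObjectProperty.homMk k') hk'
      exact ⟨l, f, f', hkk'⟩

end InvGraph

theorem theorem4 :
    HasArities InvGraph.freeGroupoidMonad.{u} InvGraph.isAcyc.{u} ∧
      (symNerve.{u}.Full ∧ symNerve.{u}.Faithful ∧
        ∀ X : SymSimplexᵒᵖ ⥤ Type u, symNerve.{u}.essImage X ↔ SymSegal X) := by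
  exact ⟨InvGraph.hasArities_freeGroupoidMonad, inferInstance, inferInstance,
    SymSimplex.symNerve_essImage_iff⟩
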